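/- Let $m_1,\dots,m_G$ be natural numbers with $n=\sum_{g}m_g$, let $\nu_g>2$ for $g=1,\dots,G$, let $P=(P_1,\dots,P_G)\in\mathbb{R}^{n\times n}$ with $P_g\in\mathbb{R}^{n\times m_g}$ satisfy $P'P=I_n$, and let $C$ be a nonsingular $n\times n$ correlation matrix (positive definite with unit diagonal). Suppose $Z\sim \mathrm{CT}^{\rm std}_{m,\nu}(0,C^{1/2}P)$, that is, $Z$ has the law of $C^{1/2}P(V_1',\dots,V_G')'$ where the $V_g\in\mathbb{R}^{m_g}$ are independent with densities $$\tfrac{\Gamma((\nu_g+m_g)/2)}{\Gamma(\nu_g/2)}[(\nu_g-2)\pi]^{-m_g/2}\Bigl(1+\tfrac{v'v}{\nu_g-2}\Bigr)^{-(\nu_g+m_g)/2}.$$ Here $C^{1/2}$ is the symmetric square root and $\log C$ the symmetric matrix logarithm. Let $\mathrm{vec}$ stack columns, let $\mathrm{vecl}$ stack the elements below the diagonal, and let $\gamma=\mathrm{vecl}(\log C)\in\mathbb{R}^{n(n-1)/2}$; then $C=C(\gamma)$ is the only correlation matrix with $\mathrm{vecl}(\log C)=\gamma$. Put $U=C^{-1/2}Z$,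 $V_g=P_g'U$, $J_g=P_gP_g'$ and $$\ell(Z)=-\tfrac12\log|C|+\sum_{g}\Bigl[\log\tfrac{\Gamma((\nu_g+m_g)/2)}{\Gamma(\nu_g/2)}-\tfrac{m_g}{2}\log[(\nu_g-2)\pi]-\tfrac{\nu_g+m_g}{2}\log\Bigl(1+\tfrac{V_g'V_g}{\nu_g-2}\Bigr)\Bigr],$$ which is the logarithm of the density of $Z$. Write $A\oplus B=A\otimes B+B\otimes A$ and $A_\otimes=A\otimes A$; let $K_n$ be the commutation matrix, $K_n\mathrm{vec}(B)=\mathrm{vec}(B')$, and let $E_l,E_u,E_d$ be the elimination matrices, $E_l\mathrm{vec}(B)=\mathrm{vecl}(B)$, $E_u\mathrm{vec}(B)=\mathrm{vecl}(B')$, $E_d\mathrm{vec}(B)=\mathrm{diag}(B)$. For any spectral decomposition $\log C=Q\,\mathrm{diag}(\lambda_1,\dots,\lambda_n)Q'$ with $Q'Q=I_n$, let $\Gamma=(Q\otimes Q)\,\Xi\,(Q\otimes Q)'$, where $\Xi$ is diagonal with entries $e^{\lambda_i}$ if $\lambda_i=\lambda_j$ and $(e^{\lambda_i}-e^{\lambda_j})/(\lambda_i-\lambda_j)$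 otherwise, at the position $(i-1)n+j$. Finally let $$M=(E_l+E_u)'E_l\bigl(I_{n^2}-\Gamma E_d'(E_d\Gamma E_d')^{-1}E_d\bigr)\Gamma(E_l+E_u)',\qquad \Omega=(I_n\otimes C^{-1/2})(C^{1/2}\oplus I_n)^{-1},$$ $$W_g=\frac{\nu_g+m_g}{\nu_g-2+V_g'V_g},\qquad \phi_g=\frac{\nu_g+m_g}{\nu_g+m_g+2},\qquad \psi_g=\phi_g\frac{\nu_g}{\nu_g-2}.$$ Then the inverses in $M$ and $\Omega$ exist, $M=\partial\mathrm{vec}(C)/\partial\gamma'$, the log-likelihood is differentiable in $\gamma$, and the score $\nabla=\partial\ell(Z)/\partial\gamma$ and the Fisher information $\mathcal{I}=\mathbb{E}(\nabla\nabla')$, whose entries are finite, are $$\nabla=M'\Omega\Bigl[\sum_{g=1}^{G}W_g\,\mathrm{vec}(P_gV_gU')-\mathrm{vec}(I_n)\Bigr],\qquad \mathcal{I}=M'\Omega\,(K_n+\Upsilon_G)\,\Omega M,$$ where $\Upsilon_G=\sum_{g=1}^{G}\Psi_g$ and $$\Psi_g=\psi_g(I_n\otimes J_g)+(\phi_g-\psi_g)J_{g\otimes}+(\phi_g-1)\bigl[J_{g\otimes}K_n+\mathrm{vec}(J_g)\mathrm{vec}(J_g)'\bigr].$$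 -/

import Mathlib

open Matrix MeasureTheory ProbabilityTheory
open scoped Kronecker

noncomputable section

namespace ConvT

/-! ### Vectorization operators and elimination matrices

`Matrix.vec` stacks columns: for `B : Matrix (Fin n) (Fin n) ℝ`, the entry of `vec B` at
`(j, i)` is `B i j`, so a position of `vec B` is a pair (column, row). -/

/-- The positions (column, row) strictly below the diagonal of an `n × n` matrix; there are
`n (n - 1) / 2` of them. The parameter space `ℝ^d`, `d = n (n - 1) / 2`, is `BelowDiag n → ℝ`. -/
abbrev BelowDiag (n : ℕ) : Type := {p : Fin n × Fin n // p.1 < p.2}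

/-- `vecl B`: the vector of the elements of `B` below the diagonal. -/
def vecl {n : ℕ} (B : Matrix (Fin n) (Fin n) ℝ) : BelowDiag n → ℝ :=
  fun a => B a.1.2 a.1.1

/-- The commutation matrix: `K_n vec B = vec Bᵀ`. -/
def commMat (n : ℕ) : Matrix (Fin n × Fin n) (Fin n × Fin n) ℝ :=
  Matrix.of fun p q => if q = p.swap then 1 else 0

/-- The elimination matrix `E_l`: `E_l vec B = vecl B`. -/
def elimL (n : ℕ) : Matrix (BelowDiag n) (Fin n × Fin n) ℝ :=
  Matrix.of fun a q => if q = a.1 then 1 else 0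

/-- The elimination matrix `E_u`: `E_u vec B = vecl Bᵀ`. -/
def elimU (n : ℕ) : Matrix (BelowDiag n) (Fin n × Fin n) ℝ :=
  Matrix.of fun a q => if q = a.1.swap then 1 else 0

/-- The elimination matrix `E_d`: `E_d vec B = diag B`. -/
def elimD (n : ℕ) : Matrix (Fin n) (Fin n × Fin n) ℝ :=
  Matrix.of fun i q => if q = (i, i) then 1 else 0

theorem commMat_mulVec_vec {n : ℕ} (B : Matrix (Fin n) (Fin n) ℝ) :
    commMat n *ᵥ vec B = vec Bᵀ := by
  ext p; simp [commMat, mulVec, dotProduct]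

theorem elimL_mulVec_vec {n : ℕ} (B : Matrix (Fin n) (Fin n) ℝ) :
    elimL n *ᵥ vec B = vecl B := by
  ext a; simp [elimL, vecl, mulVec, dotProduct]

theorem elimU_mulVec_vec {n : ℕ} (B : Matrix (Fin n) (Fin n) ℝ) :
    elimU n *ᵥ vec B = vecl Bᵀ := by
  ext a; simp [elimU, vecl, mulVec, dotProduct]

theorem elimD_mulVec_vec {n : ℕ} (B : Matrix (Fin n) (Fin n) ℝ) :
    elimD n *ᵥ vec B = diag B := by
  ext i; simp [elimD, mulVec, dotProduct]

/-- `A ⊕ B = A ⊗ B + B ⊗ A`. -/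
def kronSum {n : ℕ} (A B : Matrix (Fin n) (Fin n) ℝ) :
    Matrix (Fin n × Fin n) (Fin n × Fin n) ℝ :=
  A ⊗ₖ B + B ⊗ₖ A

/-! ### Correlation matrices and their parametrization by `vecl (log C)` -/

/-- A nonsingular correlation matrix: positive definite with unit diagonal. -/
def IsCorrelation {n : ℕ} (C : Matrix (Fin n) (Fin n) ℝ) : Prop :=
  C.PosDef ∧ ∀ i, C i i = 1

/-- The logarithm of a symmetric positive definite matrix, `Q (log Λ) Qᵀ` if `C = Q Λ Qᵀ`
(functional calculus). -/
def matLog {n : ℕ} (C : Matrix (Fin n) (Fin n) ℝ) : Matrix (Fin n) (Fin n) ℝ :=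
  cfc Real.log C

/-- The symmetric square root `C^{1/2}`, i.e. `Q Λ^{1/2} Qᵀ` if `C = Q Λ Qᵀ`
(functional calculus). -/
def matSqrt {n : ℕ} (C : Matrix (Fin n) (Fin n) ℝ) : Matrix (Fin n) (Fin n) ℝ :=
  cfc Real.sqrt C

open Classical in
/-- `C(γ)`: the correlation matrix with `vecl (log C) = γ`. -/
def corrOf {n : ℕ} (γ : BelowDiag n → ℝ) : Matrix (Fin n) (Fin n) ℝ :=
  if h : ∃ C : Matrix (Fin n) (Fin n) ℝ, IsCorrelation C ∧ vecl (matLog C) = γ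
  then h.choose else 1

/-! ### Convolution-t distributions -/

/-- The density of the standardized multivariate t-distribution `t_ν^std(0, I_k)`, `ν > 2`. -/
def tStdDensity (k : ℕ) (ν : ℝ) (v : Fin k → ℝ) : ℝ :=
  Real.Gamma ((ν + k) / 2) / Real.Gamma (ν / 2) * ((ν - 2) * Real.pi) ^ (-(k : ℝ) / 2)
    * (1 + (v ⬝ᵥ v) / (ν - 2)) ^ (-(ν + k) / 2)

/-- The standardized multivariate t-distribution `t_ν^std(0, I_k)`, `ν > 2`. -/
def tStd (k : ℕ) (ν : ℝ) : Measure (Fin k → ℝ) :=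
  volume.withDensity fun v => ENNReal.ofReal (tStdDensity k ν v)

/-- The convolution-t distribution `CT_{m,ν}^std(0, Ξ)`: the law of `Ξ V`, where
`V = (V_1', …, V_G')'` with independent `V_g ∼ t_{ν_g}^std(0, I_{m_g})`. -/
def ctStd {n G : ℕ} (m : Fin G → ℕ) (ν : Fin G → ℝ)
    (Ξ : Matrix (Fin n) (Σ g, Fin (m g)) ℝ) : Measure (Fin n → ℝ) :=
  (Measure.pi fun g => tStd (m g) (ν g)).map
    fun V => Ξ *ᵥ fun s : Σ g, Fin (m g) => V s.1 s.2

/-- The block `P_g` of columns of `P = (P_1, …, P_G)`. -/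
def colBlock {n G : ℕ} {m : Fin G → ℕ} (P : Matrix (Fin n) (Σ g, Fin (m g)) ℝ) (g : Fin G) :
    Matrix (Fin n) (Fin (m g)) ℝ :=
  P.submatrix id fun i => ⟨g, i⟩

/-- `U = C^{-1/2} Z`. -/
def uOf {n : ℕ} (C : Matrix (Fin n) (Fin n) ℝ) (z : Fin n → ℝ) : Fin n → ℝ :=
  (matSqrt C)⁻¹ *ᵥ z

/-- `V_g = P_g' U = P_g' C^{-1/2} Z`. -/
def vOf {n G : ℕ} {m : Fin G → ℕ} (P : Matrix (Fin n) (Σ g, Fin (m g)) ℝ)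
    (C : Matrix (Fin n) (Fin n) ℝ) (z : Fin n → ℝ) (g : Fin G) : Fin (m g) → ℝ :=
  (colBlock P g)ᵀ *ᵥ uOf C z

/-- The normalizing constant `c(ν, k)` of the log-density of `t_ν^std(0, I_k)`. -/
def cConst (ν : ℝ) (k : ℕ) : ℝ :=
  Real.log (Real.Gamma ((ν + k) / 2) / Real.Gamma (ν / 2))
    - (k : ℝ) / 2 * Real.log ((ν - 2) * Real.pi)

/-- The log-likelihood `ℓ(Z)` of `CT_{m,ν}^std(0, C^{1/2} P)`. -/
def logLik {n G : ℕ} (m : Fin G → ℕ) (ν : Fin G → ℝ)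
    (P : Matrix (Fin n) (Σ g, Fin (m g)) ℝ) (C : Matrix (Fin n) (Fin n) ℝ)
    (z : Fin n → ℝ) : ℝ :=
  -(1 / 2) * Real.log C.det
    + ∑ g, (cConst (ν g) (m g)
        - (ν g + m g) / 2 * Real.log (1 + (vOf P C z g ⬝ᵥ vOf P C z g) / (ν g - 2)))

/-- The log-likelihood of an observation `z` as a function of the parameter `γ`. -/
def logLikParam {n G : ℕ} (m : Fin G → ℕ) (ν : Fin G → ℝ)
    (P : Matrix (Fin n) (Σ g, Fin (m g)) ℝ) (z : Fin n → ℝ) (γ : BelowDiag n → ℝ) : ℝ :=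
  logLik m ν P (corrOf γ) z

/-- The score: the vector of partial derivatives of the log-likelihood with respect to `γ`. -/
def score {n G : ℕ} (m : Fin G → ℕ) (ν : Fin G → ℝ)
    (P : Matrix (Fin n) (Σ g, Fin (m g)) ℝ) (γ : BelowDiag n → ℝ) (z : Fin n → ℝ) :
    BelowDiag n → ℝ :=
  fun a => fderiv ℝ (logLikParam m ν P z) γ (Pi.single a 1)

/-! ### The matrices in the closed forms -/

/-- `δ_{ij}`: the divided difference of `exp` at `(x, y) = (λ_i, λ_j)`. -/
def expDivDiff (x y : ℝ) : ℝ :=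
  if x = y then Real.exp x else (Real.exp x - Real.exp y) / (x - y)

/-- `Γ = (Q ⊗ Q) diag(δ_{ij}) (Q ⊗ Q)'`, where `log C = Q diag(λ) Q'`. -/
def gammaMat {n : ℕ} (Q : Matrix (Fin n) (Fin n) ℝ) (lam : Fin n → ℝ) :
    Matrix (Fin n × Fin n) (Fin n × Fin n) ℝ :=
  (Q ⊗ₖ Q) * diagonal (fun p => expDivDiff (lam p.1) (lam p.2)) * (Q ⊗ₖ Q)ᵀ

/-- `M = (E_l + E_u)' E_l (I - Γ E_d' (E_d Γ E_d')⁻¹ E_d) Γ (E_l + E_u)'`. -/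
def mMat {n : ℕ} (Q : Matrix (Fin n) (Fin n) ℝ) (lam : Fin n → ℝ) :
    Matrix (Fin n × Fin n) (BelowDiag n) ℝ :=
  (elimL n + elimU n)ᵀ * elimL n
    * (1 - gammaMat Q lam * (elimD n)ᵀ
        * (elimD n * gammaMat Q lam * (elimD n)ᵀ)⁻¹ * elimD n)
    * gammaMat Q lam * (elimL n + elimU n)ᵀ

/-- `Ω = (I ⊗ C^{-1/2}) (C^{1/2} ⊕ I)⁻¹`. -/
def omegaMat {n : ℕ} (C : Matrix (Fin n) (Fin n) ℝ) :
    Matrix (Fin n × Fin n) (Fin n × Fin n) ℝ :=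
  ((1 : Matrix (Fin n) (Fin n) ℝ) ⊗ₖ (matSqrt C)⁻¹) * (kronSum (matSqrt C) 1)⁻¹

/-- `W_g = (ν_g + m_g) / (ν_g - 2 + V_g' V_g)`. -/
def wOf {n G : ℕ} {m : Fin G → ℕ} (ν : Fin G → ℝ) (P : Matrix (Fin n) (Σ g, Fin (m g)) ℝ)
    (C : Matrix (Fin n) (Fin n) ℝ) (z : Fin n → ℝ) (g : Fin G) : ℝ :=
  (ν g + m g) / (ν g - 2 + vOf P C z g ⬝ᵥ vOf P C z g)

/-- `J_g = P_g P_g'`. -/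
def jMat {n G : ℕ} {m : Fin G → ℕ} (P : Matrix (Fin n) (Σ g, Fin (m g)) ℝ) (g : Fin G) :
    Matrix (Fin n) (Fin n) ℝ :=
  colBlock P g * (colBlock P g)ᵀ

/-- `φ = (ν + k) / (ν + k + 2)`. -/
def phiConst (ν : ℝ) (k : ℕ) : ℝ := (ν + k) / (ν + k + 2)

/-- `ψ = φ ν / (ν - 2)`. -/
def psiConst (ν : ℝ) (k : ℕ) : ℝ := phiConst ν k * (ν / (ν - 2))

/-- `Ψ_g = ψ_g (I ⊗ J_g) + (φ_g - ψ_g) (J_g ⊗ J_g)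
  + (φ_g - 1) [(J_g ⊗ J_g) K_n + vec(J_g) vec(J_g)']`. -/
def psiMat {n G : ℕ} {m : Fin G → ℕ} (ν : Fin G → ℝ) (P : Matrix (Fin n) (Σ g, Fin (m g)) ℝ)
    (g : Fin G) : Matrix (Fin n × Fin n) (Fin n × Fin n) ℝ :=
  psiConst (ν g) (m g) • ((1 : Matrix (Fin n) (Fin n) ℝ) ⊗ₖ jMat P g)
    + (phiConst (ν g) (m g) - psiConst (ν g) (m g)) • (jMat P g ⊗ₖ jMat P g)
    + (phiConst (ν g) (m g) - 1) • ((jMat P g ⊗ₖ jMat P g) * commMat n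
        + vecMulVec (vec (jMat P g)) (vec (jMat P g)))

/-- `Υ_G = ∑_g Ψ_g`. -/
def upsilonMat {n G : ℕ} {m : Fin G → ℕ} (ν : Fin G → ℝ)
    (P : Matrix (Fin n) (Σ g, Fin (m g)) ℝ) : Matrix (Fin n × Fin n) (Fin n × Fin n) ℝ :=
  ∑ g, psiMat ν P g

end ConvT

end

noncomputable section

namespace ConvT

/-! ### Spectral decompositions, uniqueness of the correlation matrix, positivity of Γ -/

section Spectral

open NormedSpace (exp)

variable {n : ℕ} {Q R : Matrix (Fin n) (Fin n) ℝ} {d e : Fin n → ℝ}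

/-! Three computations combine: the differential of C in γ, the differential of ℓ through C^{1/2},
and the fourth-order moments of the t-distributed blocks.

Parametrization. log C is a hollow symmetric matrix filled by γ plus a diagonal x, and x is fixed by
the condition that the exponential has unit diagonal. The derivative of exp at log C has matrix Γ,
whose eigenvalues are divided differences of exp and hence positive (`fderiv_exp_conj_diagonal`,
`posDef_gammaMat`). So the derivative of the constraint in x, which is E_d Γ E_d', is positive
definite. The implicit function theorem makes x a differentiable function of γ
(`exists_log_corrOf`), and eliminating dx from the linearized constraint gives M. Uniqueness of C
comes from strict monotonicity of exp on symmetric matrices (`eq_of_trace_sub_mul_exp_sub`).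

Score. Put S = C^{1/2} and B = S⁻¹ dS. Differentiating S² = C gives a Sylvester equation, solved by
vec B = Ω vec(dC). Since d log|C| = 2 tr B and dU = -B U, the differential of ℓ is the inner product
of vec B with the bracket in the closed form (`hasFDerivAt_logLikParam`).

Information. For Z = C^{1/2} P V the bracket is P ⊗ P applied to the array W V_a V_b - δ_ab, with W
the weight of the block of a (`scoreVec_mulVec`). Its second moments are explicit: the t kernel is a
Gamma mixture of Gaussians (`lintegral_prod_pow_mul_rpow`), sign changes kill the odd monomials, and
independence factors distinct blocks. What survives are the three pairings of four indices
(`integral_weightedEntry_mul`). Conjugation by P ⊗ P turns the resulting covariance into K_n + Υ_G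
(`kronecker_mul_blockCov_mul`). -/

theorem isHermitian_conj_diagonal (Q : Matrix (Fin n) (Fin n) ℝ) (d : Fin n → ℝ) :
    (Q * diagonal d * Qᵀ).IsHermitian := by
  simp [IsHermitian, conjTranspose_eq_transpose_of_trivial, Matrix.mul_assoc]

theorem exists_conj_diagonal {A : Matrix (Fin n) (Fin n) ℝ} (hA : A.IsHermitian) :
    ∃ (Q : Matrix (Fin n) (Fin n) ℝ), Qᵀ * Q = 1 ∧ A = Q * diagonal hA.eigenvalues * Qᵀ ∧
      ∀ f : ℝ → ℝ, cfc f A = Q * diagonal (fun i => f (hA.eigenvalues i)) * Qᵀ := by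
  refine ⟨hA.eigenvectorUnitary, ?_, ?_, fun f => ?_⟩
  · have := Unitary.coe_star_mul_self hA.eigenvectorUnitary
    rwa [star_eq_conjTranspose, conjTranspose_eq_transpose_of_trivial] at this
  · conv_lhs => rw [hA.spectral_theorem]
    rw [Unitary.conjStarAlgAut_apply, star_eq_conjTranspose,
      conjTranspose_eq_transpose_of_trivial]
    rfl
  · rw [hA.cfc_eq, IsHermitian.cfc, Unitary.conjStarAlgAut_apply, star_eq_conjTranspose,
      conjTranspose_eq_transpose_of_trivial]
    rfl

/-- Two spectral decompositions of a matrix give the same value of a function of the matrix. -/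
theorem conj_diagonal_congr (hQ : Qᵀ * Q = 1) (hR : Rᵀ * R = 1)
    (h : Q * diagonal d * Qᵀ = R * diagonal e * Rᵀ) (f : ℝ → ℝ) :
    Q * diagonal (fun i => f (d i)) * Qᵀ = R * diagonal (fun i => f (e i)) * Rᵀ := by
  have hQ' : Q * Qᵀ = 1 := mul_eq_one_comm.mp hQ
  -- Q'R intertwines the two diagonals, so its nonzero entries link equal eigenvalues only; it
  -- therefore intertwines their images under `f` as well.
  have hW : diagonal d * (Qᵀ * R) = (Qᵀ * R) * diagonal e := by
    calc diagonal d * (Qᵀ * R) = (Qᵀ * Q) * diagonal d * (Qᵀ * R) := by rw [hQ, Matrix.one_mul]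
      _ = Qᵀ * (Q * diagonal d * Qᵀ) * R := by simp only [Matrix.mul_assoc]
      _ = (Qᵀ * R) * diagonal e * (Rᵀ * R) := by rw [h]; simp only [Matrix.mul_assoc]
      _ = _ := by rw [hR, Matrix.mul_one]
  have hf : diagonal (fun i => f (d i)) * (Qᵀ * R)
      = (Qᵀ * R) * diagonal (fun i => f (e i)) := by
    ext i j
    have := congrFun (congrFun hW i) j
    rw [diagonal_mul, mul_diagonal] at this ⊢
    rcases eq_or_ne ((Qᵀ * R) i j) 0 with h0 | h0
    · simp [h0]
    · have : d i = e j := mul_right_cancel₀ h0 (by rw [this, mul_comm])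
      rw [this, mul_comm]
  have hR' : R * Rᵀ = 1 := mul_eq_one_comm.mp hR
  calc Q * diagonal (fun i => f (d i)) * Qᵀ
      = Q * (diagonal (fun i => f (d i)) * (Qᵀ * R)) * Rᵀ := by
        rw [Matrix.mul_assoc, Matrix.mul_assoc, Matrix.mul_assoc, Matrix.mul_assoc, hR',
          Matrix.mul_one]
    _ = (Q * Qᵀ) * R * diagonal (fun i => f (e i)) * Rᵀ := by
        rw [hf]; simp only [Matrix.mul_assoc]
    _ = _ := by rw [hQ', Matrix.one_mul]

/-- The functional calculus is computed in an eigenbasis chosen by the spectral theorem;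
independence of that choice allows any given `Q`. -/
theorem cfc_conj_diagonal (hQ : Qᵀ * Q = 1) (d : Fin n → ℝ) (f : ℝ → ℝ) :
    cfc f (Q * diagonal d * Qᵀ) = Q * diagonal (fun i => f (d i)) * Qᵀ := by
  obtain ⟨R, hR, h1, h2⟩ := exists_conj_diagonal (isHermitian_conj_diagonal Q d)
  rw [h2]
  exact (conj_diagonal_congr hQ hR h1 f).symm

theorem exp_conj_diagonal (hQ : Qᵀ * Q = 1) (d : Fin n → ℝ) :
    exp (Q * diagonal d * Qᵀ) = Q * diagonal (fun i => Real.exp (d i)) * Qᵀ := by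
  have hQ' : Q * Qᵀ = 1 := mul_eq_one_comm.mp hQ
  have hi : Q⁻¹ = Qᵀ := Matrix.inv_eq_left_inv hQ
  rw [← hi, Matrix.exp_conj _ _ (IsUnit.of_mul_eq_one _ hQ'), Matrix.exp_diagonal,
    NormedSpace.exp_eq_tsum_rat, ← NormedSpace.exp_eq_tsum_rat]
  congr 3
  ext i
  rw [Pi.coe_exp, Real.exp_eq_exp_ℝ]

theorem conj_diagonal_mul (hQ : Qᵀ * Q = 1) (d e : Fin n → ℝ) :
    Q * diagonal d * Qᵀ * (Q * diagonal e * Qᵀ) = Q * diagonal (fun i => d i * e i) * Qᵀ := by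
  calc _ = Q * diagonal d * (Qᵀ * Q) * diagonal e * Qᵀ := by simp only [Matrix.mul_assoc]
    _ = _ := by rw [hQ, Matrix.mul_one, Matrix.mul_assoc Q, diagonal_mul_diagonal]

theorem posDef_conj_diagonal (hQ : Qᵀ * Q = 1) (hd : ∀ i, 0 < d i) :
    (Q * diagonal d * Qᵀ).PosDef := by
  have hQ' : Q * Qᵀ = 1 := mul_eq_one_comm.mp hQ
  have := (PosDef.diagonal hd).mul_mul_conjTranspose_same (B := Q) (by
    intro x y hxy
    have := congrArg (fun v => v ᵥ* Qᵀ) hxy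
    simpa [vecMul_vecMul, hQ'] using this)
  simpa [conjTranspose_eq_transpose_of_trivial] using this

theorem matLog_exp {X : Matrix (Fin n) (Fin n) ℝ} (hX : X.IsHermitian) :
    matLog (exp X) = X := by
  obtain ⟨Q, hQ, h1, -⟩ := exists_conj_diagonal hX
  rw [h1, exp_conj_diagonal hQ, matLog, cfc_conj_diagonal hQ]
  simp

theorem posDef_exp {X : Matrix (Fin n) (Fin n) ℝ} (hX : X.IsHermitian) : (exp X).PosDef := by
  obtain ⟨Q, hQ, h1, -⟩ := exists_conj_diagonal hX
  rw [h1, exp_conj_diagonal hQ]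
  exact posDef_conj_diagonal hQ fun i => Real.exp_pos _

theorem exp_matLog {C : Matrix (Fin n) (Fin n) ℝ} (hC : C.PosDef) : exp (matLog C) = C := by
  obtain ⟨Q, hQ, h1, h2⟩ := exists_conj_diagonal hC.isHermitian
  rw [matLog, h2, exp_conj_diagonal hQ]
  conv_rhs => rw [h1]
  congr 3
  ext i
  exact Real.exp_log (hC.eigenvalues_pos i)

theorem isHermitian_matLog {C : Matrix (Fin n) (Fin n) ℝ} (hC : C.PosDef) :
    (matLog C).IsHermitian := by
  obtain ⟨Q, hQ, h1, h2⟩ := exists_conj_diagonal hC.isHermitian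
  rw [matLog, h2]
  exact isHermitian_conj_diagonal _ _

/-- Through this identity the square root is differentiated with the derivative of exp alone. -/
theorem matSqrt_exp {X : Matrix (Fin n) (Fin n) ℝ} (hX : X.IsHermitian) :
    matSqrt (exp X) = exp ((1 / 2 : ℝ) • X) := by
  obtain ⟨Q, hQ, h1, -⟩ := exists_conj_diagonal hX
  generalize hX.eigenvalues = d at h1
  have : (1 / 2 : ℝ) • X = Q * diagonal (fun i => d i / 2) * Qᵀ := by
    rw [h1, ← Matrix.smul_mul, ← Matrix.mul_smul, ← diagonal_smul]
    congr 3
    ext i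
    simp; ring
  rw [this, h1, exp_conj_diagonal hQ, exp_conj_diagonal hQ, matSqrt, cfc_conj_diagonal hQ]
  congr 3
  ext i
  rw [← Real.exp_half]

theorem matSqrt_mul_self {C : Matrix (Fin n) (Fin n) ℝ} (hC : C.PosDef) :
    matSqrt C * matSqrt C = C := by
  obtain ⟨Q, hQ, h1, h2⟩ := exists_conj_diagonal hC.isHermitian
  rw [matSqrt, h2, conj_diagonal_mul hQ]
  conv_rhs => rw [h1]
  congr 3
  ext i
  exact Real.mul_self_sqrt (hC.eigenvalues_pos i).le

theorem posDef_matSqrt {C : Matrix (Fin n) (Fin n) ℝ} (hC : C.PosDef) : (matSqrt C).PosDef := by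
  obtain ⟨Q, hQ, h1, h2⟩ := exists_conj_diagonal hC.isHermitian
  rw [matSqrt, h2]
  exact posDef_conj_diagonal hQ fun i => Real.sqrt_pos.mpr (hC.eigenvalues_pos i)

theorem trace_conj_diagonal_mul (Q R : Matrix (Fin n) (Fin n) ℝ) (a b : Fin n → ℝ) :
    (Q * diagonal a * Qᵀ * (R * diagonal b * Rᵀ)).trace
      = ∑ i, ∑ j, a i * b j * (Qᵀ * R) i j ^ 2 := by
  have : (Q * diagonal a * Qᵀ * (R * diagonal b * Rᵀ)).trace
      = (diagonal a * (Qᵀ * R) * (diagonal b * (Qᵀ * R)ᵀ)).trace := by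
    rw [Matrix.mul_assoc Q, Matrix.mul_assoc Q, trace_mul_comm Q]
    simp only [Matrix.mul_assoc, transpose_mul, transpose_transpose]
  rw [this, trace]
  refine Finset.sum_congr rfl fun i _ => ?_
  rw [diag_apply, Matrix.mul_apply]
  refine Finset.sum_congr rfl fun j _ => ?_
  rw [diagonal_mul, diagonal_mul, transpose_apply]
  ring

/-- The exponential is strictly monotone on symmetric matrices. -/
theorem eq_of_trace_sub_mul_exp_sub {X Y : Matrix (Fin n) (Fin n) ℝ} (hX : X.IsHermitian)
    (hY : Y.IsHermitian) (h : ((X - Y) * (exp X - exp Y)).trace = 0) : X = Y := by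
  obtain ⟨Q, hQ, h1, -⟩ := exists_conj_diagonal hX
  obtain ⟨R, hR, h2, -⟩ := exists_conj_diagonal hY
  set d := hX.eigenvalues
  set e := hY.eigenvalues
  have hQ' : Q * Qᵀ = 1 := mul_eq_one_comm.mp hQ
  have hR' : R * Rᵀ = 1 := mul_eq_one_comm.mp hR
  have hsum : ((X - Y) * (exp X - exp Y)).trace
      = ∑ i, ∑ j, (d i - e j) * (Real.exp (d i) - Real.exp (e j)) * (Qᵀ * R) i j ^ 2 := by
    have e1 : (X * exp X).trace = ∑ i, ∑ j, (d i * Real.exp (d i)) * 1 * (Qᵀ * R) i j ^ 2 := by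
      rw [← trace_conj_diagonal_mul, h1, exp_conj_diagonal hQ, conj_diagonal_mul hQ]
      rw [diagonal_one, Matrix.mul_one, hR', Matrix.mul_one]
    have e2 : (Y * exp Y).trace = ∑ i, ∑ j, 1 * (e j * Real.exp (e j)) * (Qᵀ * R) i j ^ 2 := by
      rw [← trace_conj_diagonal_mul, h2, exp_conj_diagonal hR, conj_diagonal_mul hR]
      rw [diagonal_one, Matrix.mul_one, hQ', Matrix.one_mul]
    have e3 : (X * exp Y).trace = ∑ i, ∑ j, d i * Real.exp (e j) * (Qᵀ * R) i j ^ 2 := by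
      rw [← trace_conj_diagonal_mul, h1, h2, exp_conj_diagonal hR]
    have e4 : (Y * exp X).trace = ∑ i, ∑ j, Real.exp (d i) * e j * (Qᵀ * R) i j ^ 2 := by
      rw [← trace_conj_diagonal_mul, h1, h2, exp_conj_diagonal hQ, trace_mul_comm]
    rw [Matrix.sub_mul, Matrix.mul_sub, Matrix.mul_sub, trace_sub, trace_sub, trace_sub, e1, e2,
      e3, e4]
    simp only [← Finset.sum_sub_distrib]
    refine Finset.sum_congr rfl fun i _ => Finset.sum_congr rfl fun j _ => ?_
    ring
  -- Both factors have the same sign since exp is increasing. A zero sum thus kills every term, and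
  -- Q'R again links equal eigenvalues only.
  have hnn : ∀ i j, 0 ≤ (d i - e j) * (Real.exp (d i) - Real.exp (e j)) := fun i j => by
    rcases le_total (d i) (e j) with hl | hl
    · exact mul_nonneg_of_nonpos_of_nonpos (sub_nonpos.mpr hl)
        (sub_nonpos.mpr (Real.exp_le_exp.mpr hl))
    · exact mul_nonneg (sub_nonneg.mpr hl) (sub_nonneg.mpr (Real.exp_le_exp.mpr hl))
  replace h := (Finset.sum_eq_zero_iff_of_nonneg fun i _ => Finset.sum_nonneg fun j _ =>
    mul_nonneg (hnn i j) (sq_nonneg ((Qᵀ * R) i j))).mp (hsum ▸ h)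
  have hW : diagonal d * (Qᵀ * R) = (Qᵀ * R) * diagonal e := by
    ext i j
    have := (Finset.sum_eq_zero_iff_of_nonneg fun j _ =>
      mul_nonneg (hnn i j) (sq_nonneg _)).mp (h i (Finset.mem_univ _)) j (Finset.mem_univ _)
    rw [diagonal_mul, mul_diagonal]
    rcases mul_eq_zero.mp this with h0 | h0
    · have : d i = e j := by
        rcases mul_eq_zero.mp h0 with h0 | h0
        · exact sub_eq_zero.mp h0
        · exact Real.exp_injective (sub_eq_zero.mp h0)
      rw [this, mul_comm]
    · rw [pow_eq_zero_iff two_ne_zero] at h0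
      simp [h0]
  calc X = Q * (diagonal d * (Qᵀ * R)) * Rᵀ := by
        rw [h1, Matrix.mul_assoc, Matrix.mul_assoc, Matrix.mul_assoc, Matrix.mul_assoc, hR',
          Matrix.mul_one]
    _ = (Q * Qᵀ) * R * diagonal e * Rᵀ := by rw [hW]; simp only [Matrix.mul_assoc]
    _ = Y := by rw [hQ', Matrix.one_mul, ← h2]

theorem isHermitian_apply {A : Matrix (Fin n) (Fin n) ℝ} (hA : A.IsHermitian) (i j : Fin n) :
    A i j = A j i := by
  simpa using hA.apply j i

/-- A correlation matrix is determined by the off-diagonal elements of its logarithm. -/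
theorem IsCorrelation.eq_of_vecl_matLog {C D : Matrix (Fin n) (Fin n) ℝ} (hC : IsCorrelation C)
    (hD : IsCorrelation D) (h : vecl (matLog C) = vecl (matLog D)) : C = D := by
  have hoff : ∀ i j, i ≠ j → (matLog C - matLog D) i j = 0 := by
    intro i j hij
    rw [Matrix.sub_apply, sub_eq_zero]
    rcases lt_or_gt_of_ne hij with hl | hl
    · rw [isHermitian_apply (isHermitian_matLog hC.1), isHermitian_apply (isHermitian_matLog hD.1)]
      exact congrFun h ⟨(i, j), hl⟩
    · exact congrFun h ⟨(j, i), hl⟩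
  -- The logarithms differ by a diagonal matrix, while C and D differ by a matrix with zero
  -- diagonal, so the trace of the product has only zero terms.
  have := eq_of_trace_sub_mul_exp_sub (isHermitian_matLog hC.1) (isHermitian_matLog hD.1) (by
    rw [exp_matLog hC.1, exp_matLog hD.1, trace]
    refine Finset.sum_eq_zero fun i _ => ?_
    rw [diag_apply, Matrix.mul_apply]
    refine Finset.sum_eq_zero fun j _ => ?_
    rcases eq_or_ne i j with rfl | hij
    · simp [hC.2, hD.2]
    · rw [hoff i j hij, zero_mul])
  rw [← exp_matLog hC.1, ← exp_matLog hD.1, this]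

/-- Uniqueness makes the choice in `corrOf` immaterial. -/
theorem corrOf_eq {C : Matrix (Fin n) (Fin n) ℝ} {γ : BelowDiag n → ℝ} (hC : IsCorrelation C)
    (h : vecl (matLog C) = γ) : corrOf γ = C := by
  have hex : ∃ C : Matrix (Fin n) (Fin n) ℝ, IsCorrelation C ∧ vecl (matLog C) = γ := ⟨C, hC, h⟩
  rw [corrOf, dif_pos hex]
  exact hex.choose_spec.1.eq_of_vecl_matLog hC (hex.choose_spec.2.trans h.symm)

/-- In vec form this is the Sylvester operator X ↦ S X + X S; its positivity provides the inverse in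
Ω. -/
theorem posDef_kronSum_one {S : Matrix (Fin n) (Fin n) ℝ} (hS : S.PosDef) :
    (kronSum S 1).PosDef :=
  (hS.kronecker PosDef.one).add (PosDef.one.kronecker hS)

theorem expDivDiff_pos (x y : ℝ) : 0 < expDivDiff x y := by
  unfold expDivDiff
  split_ifs with h
  · exact Real.exp_pos _
  · rcases lt_or_gt_of_ne h with hl | hl
    · exact div_pos_of_neg_of_neg (sub_neg.mpr (Real.exp_lt_exp.mpr hl)) (sub_neg.mpr hl)
    · exact div_pos (sub_pos.mpr (Real.exp_lt_exp.mpr hl)) (sub_pos.mpr hl)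

theorem expDivDiff_comm (x y : ℝ) : expDivDiff x y = expDivDiff y x := by
  unfold expDivDiff
  split_ifs with h1 h2 h2
  · rw [h1]
  · exact absurd h1.symm h2
  · exact absurd h2.symm h1
  · rw [← neg_sub (Real.exp y), ← neg_sub y, neg_div_neg_eq]

theorem kronecker_transpose_mul_self (hQ : Qᵀ * Q = 1) : (Q ⊗ₖ Q)ᵀ * (Q ⊗ₖ Q) = 1 := by
  rw [← kroneckerMap_transpose, ← mul_kronecker_mul, hQ, one_kronecker_one]

/-- An orthogonal congruence of a diagonal matrix whose entries are positive because exp is strictly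
increasing. -/
theorem posDef_gammaMat (hQ : Qᵀ * Q = 1) (lam : Fin n → ℝ) : (gammaMat Q lam).PosDef := by
  have hK := kronecker_transpose_mul_self hQ
  have := (PosDef.diagonal (fun p : Fin n × Fin n =>
    expDivDiff_pos (lam p.1) (lam p.2))).mul_mul_conjTranspose_same (B := Q ⊗ₖ Q) (by
    intro x y hxy
    have := congrArg (fun v => v ᵥ* (Q ⊗ₖ Q)ᵀ) hxy
    simpa [vecMul_vecMul, mul_eq_one_comm.mp hK] using this)
  simpa [conjTranspose_eq_transpose_of_trivial, gammaMat] using this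

theorem transpose_elimD_mulVec (x : Fin n → ℝ) : (elimD n)ᵀ *ᵥ x = vec (diagonal x) := by
  ext ⟨j, i⟩
  simp only [elimD, mulVec, dotProduct, transpose_apply, of_apply, vec, diagonal_apply,
    Prod.mk.injEq, ite_mul, one_mul, zero_mul]
  rcases eq_or_ne i j with rfl | h
  · simp
  · rw [if_neg h]
    exact Finset.sum_eq_zero fun k _ => if_neg fun hk => h (hk.2.trans hk.1.symm)

/-- The transpose of E_d embeds a vector as the vec of a diagonal matrix and is injective, so
positivity passes from Γ to its compression. This matrix is the Jacobian to be inverted in the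
implicit function theorem. -/
theorem posDef_elimD_gammaMat (hQ : Qᵀ * Q = 1) (lam : Fin n → ℝ) :
    (elimD n * gammaMat Q lam * (elimD n)ᵀ).PosDef := by
  have := (posDef_gammaMat hQ lam).mul_mul_conjTranspose_same (B := elimD n) (by
    intro x y hxy
    simp only [← mulVec_transpose] at hxy
    rw [transpose_elimD_mulVec, transpose_elimD_mulVec, vec_inj] at hxy
    exact diagonal_injective hxy)
  simpa [conjTranspose_eq_transpose_of_trivial] using this

theorem transpose_elim_mulVec (γ : BelowDiag n → ℝ) (i j : Fin n) :
    ((elimL n + elimU n)ᵀ *ᵥ γ) (j, i)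
      = if h : j < i then γ ⟨(j, i), h⟩ else if h : i < j then γ ⟨(i, j), h⟩ else 0 := by
  simp only [mulVec, dotProduct, transpose_apply, Matrix.add_apply, elimL, elimU, of_apply, add_mul,
    ite_mul, one_mul, zero_mul, Finset.sum_add_distrib]
  have key : ∀ p : Fin n × Fin n, (∑ a : BelowDiag n, if p = a.1 then γ a else 0)
      = if h : p.1 < p.2 then γ ⟨p, h⟩ else 0 := by
    intro p
    split_ifs with h
    · rw [Finset.sum_eq_single ⟨p, h⟩] <;> simp +contextual [Subtype.ext_iff, eq_comm]
    · exact Finset.sum_eq_zero fun a _ => if_neg fun ha => h (by rw [ha]; exact a.2)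
  have h2 : ∀ a : BelowDiag n, ((j, i) = a.1.swap) ↔ ((i, j) = a.1) := fun a => by
    rw [← Prod.swap_inj, Prod.swap_swap, Prod.swap_prod_mk]
  simp only [h2, key]
  rcases lt_trichotomy i j with h | h | h
  · simp [h, h.not_gt]
  · simp [h]
  · simp [h, h.not_gt]

/-- A symmetric matrix with zero diagonal is recovered from its elements below the diagonal. -/
theorem transpose_elim_mulVec_vecl {B : Matrix (Fin n) (Fin n) ℝ} (hB : B.IsHermitian)
    (hd : ∀ i, B i i = 0) : (elimL n + elimU n)ᵀ *ᵥ vecl B = vec B := by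
  ext ⟨j, i⟩
  rw [transpose_elim_mulVec]
  split_ifs with h1 h2
  · rfl
  · exact isHermitian_apply hB _ _
  · obtain rfl : i = j := le_antisymm (not_lt.mp h1) (not_lt.mp h2)
    exact (hd i).symm

end Spectral

/-! ### The derivative of the matrix exponential -/

section ExpDeriv

open NormedSpace (exp)
open scoped Matrix.Norms.Operator Topology

variable {n : ℕ} {Q : Matrix (Fin n) (Fin n) ℝ}

theorem hasStrictFDerivAt_exp (X : Matrix (Fin n) (Fin n) ℝ) :
    HasStrictFDerivAt (exp : Matrix (Fin n) (Fin n) ℝ → Matrix (Fin n) (Fin n) ℝ)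
      (fderiv ℝ exp X) X :=
  (NormedSpace.exp_analytic (𝕂 := ℝ) X).hasStrictFDerivAt

theorem hasDerivAt_exp_smul_zero (K : Matrix (Fin n) (Fin n) ℝ) :
    HasDerivAt (fun t : ℝ => exp (t • K)) K 0 := by
  have := hasDerivAt_exp_smul_const (𝕂 := ℝ) K 0
  rw [zero_smul, NormedSpace.exp_zero, Matrix.one_mul] at this
  exact this

/-- Along a commuting direction exp(X + tH) = exp(X) exp(tH); differentiate at t = 0. -/
theorem fderiv_exp_of_commute {X H : Matrix (Fin n) (Fin n) ℝ} (h : Commute X H) :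
    fderiv ℝ exp X H = exp X * H := by
  have h1 : HasDerivAt (fun t : ℝ => exp (X + t • H)) (fderiv ℝ exp X H) 0 := by
    have hl : HasDerivAt (fun t : ℝ => X + t • H) H 0 := by
      have := ((hasDerivAt_id' (0 : ℝ)).smul_const H).const_add X
      rwa [one_smul] at this
    have hs : HasFDerivAt (exp : Matrix (Fin n) (Fin n) ℝ → _) (fderiv ℝ exp X)
        (X + (0 : ℝ) • H) := by
      simpa using (hasStrictFDerivAt_exp X).hasFDerivAt
    exact hs.comp_hasDerivAt 0 hl
  have h2 : HasDerivAt (fun t : ℝ => exp (X + t • H)) (exp X * H) 0 := by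
    have : (fun t : ℝ => exp (X + t • H)) = fun t : ℝ => exp X * exp (t • H) := by
      ext1 t
      exact Matrix.exp_add_of_commute _ _ (h.smul_right t)
    rw [this]
    exact (hasDerivAt_exp_smul_zero H).const_mul (exp X)
  exact h1.unique h2

theorem hasDerivAt_exp_conj (X K : Matrix (Fin n) (Fin n) ℝ) :
    HasDerivAt (fun t : ℝ => exp (t • (-K)) * X * exp (t • K)) (X * K - K * X) 0 := by
  have := ((hasDerivAt_exp_smul_zero (-K)).mul_const X).mul (hasDerivAt_exp_smul_zero K)
  convert! this using 1
  simp
  abel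

/-- Differentiate exp(e^{-tK} X e^{tK}) = e^{-tK} e^X e^{tK} at t = 0. Commuting directions and
commutators together span all directions at a symmetric X, so no integral formula for the derivative
is needed. -/
theorem fderiv_exp_commutator (X K : Matrix (Fin n) (Fin n) ℝ) :
    fderiv ℝ exp X (X * K - K * X) = exp X * K - K * exp X := by
  have h1 : HasDerivAt (fun t : ℝ => exp (exp (t • (-K)) * X * exp (t • K)))
      (fderiv ℝ exp X (X * K - K * X)) 0 := by
    have hs : HasFDerivAt (exp : Matrix (Fin n) (Fin n) ℝ → _) (fderiv ℝ exp X)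
        (exp ((0 : ℝ) • (-K)) * X * exp ((0 : ℝ) • K)) := by
      simpa using (hasStrictFDerivAt_exp X).hasFDerivAt
    exact hs.comp_hasDerivAt 0 (hasDerivAt_exp_conj X K)
  have h2 : (fun t : ℝ => exp (exp (t • (-K)) * X * exp (t • K)))
      = fun t : ℝ => exp (t • (-K)) * exp X * exp (t • K) := by
    ext1 t
    have hinv : exp (t • K) = (exp (t • (-K)))⁻¹ := by
      rw [← Matrix.exp_neg, smul_neg, neg_neg]
    rw [hinv]
    exact Matrix.exp_conj _ _ (Matrix.isUnit_exp _)
  rw [h2] at h1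
  exact h1.unique (hasDerivAt_exp_conj (exp X) K)

/-- The derivative of the matrix exponential in an eigenbasis. -/
theorem fderiv_exp_conj_diagonal (hQ : Qᵀ * Q = 1) (d : Fin n → ℝ)
    (H : Matrix (Fin n) (Fin n) ℝ) :
    fderiv ℝ exp (Q * diagonal d * Qᵀ) H
      = Q * of (fun i j => expDivDiff (d i) (d j) * (Qᵀ * H * Q) i j) * Qᵀ := by
  have hQ' : Q * Qᵀ = 1 := mul_eq_one_comm.mp hQ
  set X := Q * diagonal d * Qᵀ with hX
  set B := Qᵀ * H * Q with hB
  have hconj : ∀ A D : Matrix (Fin n) (Fin n) ℝ,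
      Q * A * Qᵀ * (Q * D * Qᵀ) = Q * (A * D) * Qᵀ := fun A D => by
    calc _ = Q * A * (Qᵀ * Q) * D * Qᵀ := by simp only [Matrix.mul_assoc]
      _ = _ := by rw [hQ]; simp only [Matrix.mul_assoc, Matrix.mul_one]
  -- In the eigenbasis, the entries of `B` joining equal eigenvalues form a part commuting with
  -- `diagonal d`. The other entries are the commutator of `diagonal d` with `K`, which explains the
  -- division by d_i - d_j.
  set B₁ : Matrix (Fin n) (Fin n) ℝ := of fun i j => if d i = d j then B i j else 0 with hB₁
  set K : Matrix (Fin n) (Fin n) ℝ :=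
    of fun i j => if d i = d j then 0 else B i j / (d i - d j) with hK
  have hH : H = Q * B₁ * Qᵀ + (X * (Q * K * Qᵀ) - Q * K * Qᵀ * X) := by
    have h1 : B = B₁ + (diagonal d * K - K * diagonal d) := by
      ext i j
      simp only [Matrix.add_apply, Matrix.sub_apply, diagonal_mul, mul_diagonal, hB₁, hK, of_apply]
      split_ifs with h
      · simp
      · have : d i - d j ≠ 0 := sub_ne_zero.mpr h
        field_simp
        ring
    have h2 : H = Q * B * Qᵀ := by
      calc H = (Q * Qᵀ) * H * (Q * Qᵀ) := by rw [hQ', Matrix.one_mul, Matrix.mul_one]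
        _ = _ := by rw [hB]; simp only [Matrix.mul_assoc]
    rw [hX, hconj, hconj, ← Matrix.sub_mul, ← Matrix.mul_sub, ← Matrix.add_mul, ← Matrix.mul_add,
      ← h1, ← h2]
  have hc : Commute X (Q * B₁ * Qᵀ) := by
    rw [Commute, SemiconjBy, hX, hconj, hconj]
    congr 2
    ext i j
    simp only [diagonal_mul, mul_diagonal, hB₁, of_apply]
    split_ifs with h
    · rw [h, mul_comm]
    · simp
  have hexp : exp X = Q * diagonal (fun i => Real.exp (d i)) * Qᵀ := exp_conj_diagonal hQ d
  conv_lhs => rw [hH]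
  rw [map_add, fderiv_exp_of_commute hc, fderiv_exp_commutator, hexp, hconj, hconj, hconj,
    ← Matrix.sub_mul, ← Matrix.mul_sub, ← Matrix.add_mul, ← Matrix.mul_add]
  congr 2
  ext i j
  simp only [Matrix.add_apply, Matrix.sub_apply, diagonal_mul, mul_diagonal, hB₁, hK, of_apply,
    expDivDiff]
  split_ifs with h
  · simp
  · ring

theorem gammaMat_mulVec_vec (hQ : Qᵀ * Q = 1) (d : Fin n → ℝ) (H : Matrix (Fin n) (Fin n) ℝ) :
    gammaMat Q d *ᵥ vec H = vec (fderiv ℝ exp (Q * diagonal d * Qᵀ) H) := by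
  rw [fderiv_exp_conj_diagonal hQ, gammaMat, ← mulVec_mulVec, ← mulVec_mulVec,
    ← kroneckerMap_transpose, kronecker_mulVec_vec]
  refine Eq.trans (congrArg ((Q ⊗ₖ Q) *ᵥ ·) ?_) (kronecker_mulVec_vec Q _ Q)
  ext ⟨j, i⟩
  rw [mulVec_diagonal, transpose_transpose]
  simp only [vec, of_apply]
  -- Positions of a vec are (column, row), so the divided difference appears with its arguments
  -- exchanged.
  rw [expDivDiff_comm]

/-- Symmetry of dC is what allows its recovery from the elements below the diagonal. -/
theorem isHermitian_fderiv_exp {X H : Matrix (Fin n) (Fin n) ℝ} (hX : X.IsHermitian)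
    (hH : H.IsHermitian) : (fderiv ℝ exp X H).IsHermitian := by
  obtain ⟨Q, hQ, h1, -⟩ := exists_conj_diagonal hX
  generalize hX.eigenvalues = d at h1
  have hB : (Qᵀ * H * Q).IsHermitian := by
    rw [IsHermitian, conjTranspose_eq_transpose_of_trivial] at hH ⊢
    rw [transpose_mul, transpose_mul, transpose_transpose, hH, Matrix.mul_assoc]
  have hD : (of fun i j => expDivDiff (d i) (d j) * (Qᵀ * H * Q) i j)ᵀ
      = of fun i j => expDivDiff (d i) (d j) * (Qᵀ * H * Q) i j := by
    ext i j
    rw [transpose_apply, of_apply, of_apply, expDivDiff_comm, isHermitian_apply hB]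
  rw [h1, fderiv_exp_conj_diagonal hQ, IsHermitian, conjTranspose_eq_transpose_of_trivial,
    transpose_mul, transpose_mul, transpose_transpose, hD, ← Matrix.mul_assoc]

/-- The derivative of `log det exp X = tr X`. -/
theorem trace_exp_neg_mul_fderiv_exp {X : Matrix (Fin n) (Fin n) ℝ} (hX : X.IsHermitian)
    (H : Matrix (Fin n) (Fin n) ℝ) : ((exp X)⁻¹ * fderiv ℝ exp X H).trace = H.trace := by
  obtain ⟨Q, hQ, h1, -⟩ := exists_conj_diagonal hX
  generalize hX.eigenvalues = d at h1
  have hQ' : Q * Qᵀ = 1 := mul_eq_one_comm.mp hQ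
  have h2 : (exp X)⁻¹ = Q * diagonal (fun i => Real.exp (-d i)) * Qᵀ := by
    rw [h1, exp_conj_diagonal hQ]
    refine Matrix.inv_eq_left_inv ?_
    rw [conj_diagonal_mul hQ]
    simp [← Real.exp_add, hQ']
  rw [h2, h1, fderiv_exp_conj_diagonal hQ]
  have h3 : H.trace = (Qᵀ * H * Q).trace := by
    rw [trace_mul_comm, ← Matrix.mul_assoc, hQ', Matrix.one_mul]
  rw [h3]
  have h4 : ∀ A D : Matrix (Fin n) (Fin n) ℝ, (Q * A * Qᵀ * (Q * D * Qᵀ)).trace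
      = (A * D).trace := fun A D => by
    calc _ = (Q * (A * (Qᵀ * Q) * D * Qᵀ)).trace := by simp only [Matrix.mul_assoc]
      _ = _ := by rw [trace_mul_comm, hQ, Matrix.mul_one, Matrix.mul_assoc, hQ, Matrix.mul_one]
  -- The trace sees only the diagonal, where the divided difference is e^{d_i} and cancels e^{-d_i}.
  rw [h4, trace, trace]
  refine Finset.sum_congr rfl fun i _ => ?_
  rw [diag_apply, diag_apply, diagonal_mul, of_apply, expDivDiff, if_pos rfl, ← mul_assoc,
    ← Real.exp_add]
  simp

theorem log_det_exp {X : Matrix (Fin n) (Fin n) ℝ} (hX : X.IsHermitian) :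
    Real.log (exp X).det = X.trace := by
  obtain ⟨Q, hQ, h1, -⟩ := exists_conj_diagonal hX
  generalize hX.eigenvalues = d at h1
  rw [h1, exp_conj_diagonal hQ, det_mul_right_comm, trace_mul_comm, ← Matrix.mul_assoc, hQ,
    Matrix.one_mul, mul_eq_one_comm.mp hQ, Matrix.one_mul, det_diagonal, ← Real.exp_sum,
    Real.log_exp, trace_diagonal]

end ExpDeriv

/-! ### The parametrization γ ↦ C(γ) and its Jacobian M -/

section Param

open NormedSpace (exp)
open scoped Matrix.Norms.Operator Topology

variable {n : ℕ} {Q : Matrix (Fin n) (Fin n) ℝ}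

/-- The symmetric matrix with zero diagonal and `vecl` equal to `γ`. -/
def hollowOf (γ : BelowDiag n → ℝ) : Matrix (Fin n) (Fin n) ℝ :=
  of fun i j => ((elimL n + elimU n)ᵀ *ᵥ γ) (j, i)

theorem vec_hollowOf (γ : BelowDiag n → ℝ) :
    vec (hollowOf γ) = (elimL n + elimU n)ᵀ *ᵥ γ := rfl

theorem isHermitian_hollowOf (γ : BelowDiag n → ℝ) : (hollowOf γ).IsHermitian := by
  ext i j
  simp only [conjTranspose_apply, hollowOf, of_apply, transpose_elim_mulVec, star_trivial]
  rcases lt_trichotomy i j with h | h | h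
  · simp [h, h.not_gt]
  · simp [h]
  · simp [h, h.not_gt]

theorem vecl_hollowOf_add_diagonal (γ : BelowDiag n → ℝ) (x : Fin n → ℝ) :
    vecl (hollowOf γ + diagonal x) = γ := by
  ext ⟨⟨j, i⟩, h : j < i⟩
  rw [vecl, Matrix.add_apply, hollowOf, of_apply, transpose_elim_mulVec, dif_pos h,
    diagonal_apply_ne _ h.ne', add_zero]

theorem hollowOf_vecl_add_diagonal {A : Matrix (Fin n) (Fin n) ℝ} (hA : A.IsHermitian) :
    hollowOf (vecl A) + diagonal (diag A) = A := by
  ext i j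
  rw [Matrix.add_apply, hollowOf, of_apply, transpose_elim_mulVec]
  rcases lt_trichotomy i j with h | h | h
  · simp [h, h.not_gt, h.ne, vecl, isHermitian_apply hA j i]
  · simp [h]
  · simp [h, h.ne', vecl]

/-- The symmetric matrix with the given elements below the diagonal and on the diagonal. -/
def symmOf (n : ℕ) : ((BelowDiag n → ℝ) × (Fin n → ℝ)) →L[ℝ] Matrix (Fin n) (Fin n) ℝ :=
  LinearMap.toContinuousLinearMap
    { toFun := fun u => hollowOf u.1 + diagonal u.2
      map_add' := fun u v => by
        rw [← vec_inj]
        simp only [vec_add, vec_hollowOf, Prod.fst_add, Prod.snd_add, mulVec_add,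
          ← transpose_elimD_mulVec]
        abel
      map_smul' := fun c u => by
        rw [← vec_inj]
        simp only [vec_add, vec_hollowOf, Prod.smul_fst, Prod.smul_snd, mulVec_smul,
          ← transpose_elimD_mulVec, vec_smul, smul_add, RingHom.id_apply] }

theorem symmOf_apply (u : (BelowDiag n → ℝ) × (Fin n → ℝ)) :
    symmOf n u = hollowOf u.1 + diagonal u.2 := rfl

theorem isHermitian_symmOf (u : (BelowDiag n → ℝ) × (Fin n → ℝ)) : (symmOf n u).IsHermitian :=
  (isHermitian_hollowOf _).add (isHermitian_diagonal _)

theorem vec_symmOf (u : (BelowDiag n → ℝ) × (Fin n → ℝ)) :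
    vec (symmOf n u) = (elimL n + elimU n)ᵀ *ᵥ u.1 + (elimD n)ᵀ *ᵥ u.2 := by
  rw [symmOf_apply, vec_add, vec_hollowOf, transpose_elimD_mulVec]

/-- The diagonal of a matrix, as a continuous linear map. -/
def diagCLM (n : ℕ) : Matrix (Fin n) (Fin n) ℝ →L[ℝ] (Fin n → ℝ) :=
  LinearMap.toContinuousLinearMap (diagLinearMap (Fin n) ℝ ℝ)

theorem diagCLM_apply (A : Matrix (Fin n) (Fin n) ℝ) : diagCLM n A = diag A := rfl

theorem corrOf_vecl_matLog {C : Matrix (Fin n) (Fin n) ℝ} (hC : IsCorrelation C) :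
    corrOf (vecl (matLog C)) = C :=
  corrOf_eq hC rfl

/-- Near `γ = vecl (log C)`, the parametrization is the exponential of a differentiable function
with values in the symmetric matrices, and its derivative satisfies the linearization of
`diag C(γ) = 1`. -/
theorem exists_log_corrOf {C : Matrix (Fin n) (Fin n) ℝ} (hC : IsCorrelation C) :
    ∃ (L : (BelowDiag n → ℝ) → Matrix (Fin n) (Fin n) ℝ)
      (x' : (BelowDiag n → ℝ) →L[ℝ] (Fin n → ℝ)),
      L (vecl (matLog C)) = matLog C ∧ (∀ γ, (L γ).IsHermitian) ∧
      HasFDerivAt L ((symmOf n).comp ((ContinuousLinearMap.id ℝ _).prod x')) (vecl (matLog C)) ∧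
      (∀ᶠ γ in 𝓝 (vecl (matLog C)), corrOf γ = exp (L γ)) ∧
      ∀ h, diag (fderiv ℝ exp (matLog C) (symmOf n (h, x' h))) = 0 := by
  set γ₀ := vecl (matLog C) with hγ₀
  set x₀ := diag (matLog C) with hx₀
  have hsym := isHermitian_matLog hC.1
  have hA₀ : symmOf n (γ₀, x₀) = matLog C := hollowOf_vecl_add_diagonal hsym
  obtain ⟨Q, hQ, hQd, -⟩ := exists_conj_diagonal hsym
  generalize hsym.eigenvalues = d at hQd
  have hF : HasStrictFDerivAt (fun u => diagCLM n (exp (symmOf n u)))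
      ((diagCLM n).comp ((fderiv ℝ exp (matLog C)).comp (symmOf n))) (γ₀, x₀) := by
    have := hasStrictFDerivAt_exp (symmOf n (γ₀, x₀))
    rw [hA₀] at this
    refine (diagCLM n).hasStrictFDerivAt.comp _ (HasStrictFDerivAt.comp _ ?_
      (symmOf n).hasStrictFDerivAt)
    rwa [hA₀]
  -- A variation of x alone moves the logarithm by a diagonal matrix, so the partial Jacobian is E_d
  -- Γ E_d'.
  have hpart : ∀ x, ((diagCLM n).comp ((fderiv ℝ exp (matLog C)).comp (symmOf n))) (0, x)
      = (elimD n * gammaMat Q d * (elimD n)ᵀ) *ᵥ x := fun x => by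
    rw [← mulVec_mulVec, ← mulVec_mulVec, transpose_elimD_mulVec, gammaMat_mulVec_vec hQ,
      elimD_mulVec_vec, ← hQd]
    have : symmOf n (0, x) = diagonal x := by
      rw [← vec_inj, vec_symmOf, mulVec_zero, zero_add, transpose_elimD_mulVec]
    simp only [ContinuousLinearMap.comp_apply, this, diagCLM_apply]
  have hinv : (((diagCLM n).comp ((fderiv ℝ exp (matLog C)).comp (symmOf n))) ∘L
      ContinuousLinearMap.inr ℝ (BelowDiag n → ℝ) (Fin n → ℝ)).IsInvertible := by
    have hu := (posDef_elimD_gammaMat hQ d).isUnit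
    have hbij : Function.Bijective (elimD n * gammaMat Q d * (elimD n)ᵀ).mulVec :=
      
      ⟨mulVec_injective_iff_isUnit.mpr hu, mulVec_surjective_iff_isUnit.mpr hu⟩
    refine ⟨(LinearEquiv.ofBijective (elimD n * gammaMat Q d * (elimD n)ᵀ).mulVecLin
      hbij).toContinuousLinearEquiv, ?_⟩
    ext1 x
    exact (hpart x).symm
  set ψ := hF.implicitFunctionOfProdDomain hinv with hψ
  have hψ₀ : ψ γ₀ = x₀ :=
    (hF.eventually_apply_eq_iff_implicitFunctionOfProdDomain hinv).self_of_nhds.mp rfl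
  have hψd := (hF.hasStrictFDerivAt_implicitFunctionOfProdDomain hinv).hasFDerivAt
  have hψe := hF.eventually_apply_implicitFunctionOfProdDomain hinv
  rw [← hψ] at hψd hψe
  -- The formula for the derivative of the implicit function can be forgotten: the linearized
  -- constraint below determines it.
  generalize (-(((diagCLM n).comp ((fderiv ℝ exp (matLog C)).comp (symmOf n))) ∘L
    ContinuousLinearMap.inr ℝ (BelowDiag n → ℝ) (Fin n → ℝ)).inverse ∘L
    (((diagCLM n).comp ((fderiv ℝ exp (matLog C)).comp (symmOf n))) ∘L
    ContinuousLinearMap.inl ℝ (BelowDiag n → ℝ) (Fin n → ℝ))) = x' at hψd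
  have hpair : HasFDerivAt (fun γ => (γ, ψ γ)) ((ContinuousLinearMap.id ℝ _).prod x') γ₀ :=
    (hasFDerivAt_id γ₀).prodMk hψd
  have hval : diagCLM n (exp (symmOf n (γ₀, x₀))) = 1 := by
    rw [hA₀, exp_matLog hC.1]
    exact funext hC.2
  refine ⟨fun γ => symmOf n (γ, ψ γ), x', ?_, fun γ => isHermitian_symmOf _, ?_, ?_, fun h => ?_⟩
  · simp only [hψ₀, hA₀]
  · exact (symmOf n).hasFDerivAt.comp γ₀ hpair
  · filter_upwards [hψe] with γ hγ
    have hs := isHermitian_symmOf (γ, ψ γ)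
    refine corrOf_eq ⟨posDef_exp hs, fun i => ?_⟩ ?_
    · exact congrFun (hγ.trans hval) i
    · rw [matLog_exp hs]
      exact vecl_hollowOf_add_diagonal _ _
  -- The diagonal of the exponential is constant along the implicit function, so the derivative of
  -- the composite is zero.
  · have hF' := hF.hasFDerivAt
    rw [← hψ₀] at hF'
    have h1 := hF'.comp γ₀ hpair
    have h2 : HasFDerivAt ((fun u => diagCLM n (exp (symmOf n u))) ∘ fun γ => (γ, ψ γ))
        (0 : (BelowDiag n → ℝ) →L[ℝ] (Fin n → ℝ)) γ₀ :=
      (hasFDerivAt_const (diagCLM n (exp (symmOf n (γ₀, x₀)))) γ₀).congr_of_eventuallyEq hψe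
    exact DFunLike.congr_fun (h1.unique h2) h

/-- The closed form of the differential of the parametrization. -/
theorem vec_fderiv_exp_eq_mMat {C : Matrix (Fin n) (Fin n) ℝ} (hC : C.PosDef) {lam : Fin n → ℝ}
    (hQ : Qᵀ * Q = 1) (hlog : matLog C = Q * diagonal lam * Qᵀ) {h : BelowDiag n → ℝ}
    {x : Fin n → ℝ} (hx : diag (fderiv ℝ exp (matLog C) (symmOf n (h, x))) = 0) :
    vec (fderiv ℝ exp (matLog C) (symmOf n (h, x))) = mMat Q lam *ᵥ h := by
  have hB : vec (fderiv ℝ exp (matLog C) (symmOf n (h, x)))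
      = (1 - gammaMat Q lam * (elimD n)ᵀ * (elimD n * gammaMat Q lam * (elimD n)ᵀ)⁻¹ * elimD n)
        *ᵥ (gammaMat Q lam *ᵥ ((elimL n + elimU n)ᵀ *ᵥ h)) := by
    have h1 := gammaMat_mulVec_vec hQ lam (symmOf n (h, x))
    rw [← hlog, vec_symmOf, mulVec_add] at h1
    -- The linearized constraint, to be solved for `x` by inverting E_d Γ E_d'.
    have h2 : elimD n *ᵥ (gammaMat Q lam *ᵥ ((elimL n + elimU n)ᵀ *ᵥ h))
        = -((elimD n * gammaMat Q lam * (elimD n)ᵀ) *ᵥ x) := by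
      rw [← elimD_mulVec_vec, ← h1, mulVec_add] at hx
      rw [eq_neg_iff_add_eq_zero, ← hx, ← mulVec_mulVec, ← mulVec_mulVec]
    have hu := (Matrix.isUnit_iff_isUnit_det _).mp (posDef_elimD_gammaMat hQ lam).isUnit
    rw [sub_mulVec, one_mulVec, ← mulVec_mulVec, h2, ← mulVec_mulVec, mulVec_neg,
      mulVec_mulVec x, nonsing_inv_mul _ hu, one_mulVec, mulVec_neg, ← mulVec_mulVec,
      sub_neg_eq_add, h1]
  -- Since dC is symmetric with zero diagonal, (E_l + E_u)' E_l fixes its vec; this accounts for the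
  -- leading factor of M.
  have hsymm := isHermitian_fderiv_exp (isHermitian_matLog hC) (isHermitian_symmOf (h, x))
  rw [← transpose_elim_mulVec_vecl hsymm (congrFun hx), ← elimL_mulVec_vec, hB, mMat]
  simp only [mulVec_mulVec, Matrix.mul_assoc]

theorem hasFDerivAt_vec_corrOf {C : Matrix (Fin n) (Fin n) ℝ} (hC : IsCorrelation C)
    {lam : Fin n → ℝ} (hQ : Qᵀ * Q = 1) (hlog : matLog C = Q * diagonal lam * Qᵀ) :
    HasFDerivAt (fun γ : BelowDiag n → ℝ => vec (corrOf γ))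
      (LinearMap.toContinuousLinearMap (mMat Q lam).mulVecLin) (vecl (matLog C)) := by
  obtain ⟨L, x', hL₀, -, hL, hev, hd⟩ := exists_log_corrOf hC
  let vecL : Matrix (Fin n) (Fin n) ℝ →L[ℝ] (Fin n × Fin n → ℝ) :=
    LinearMap.toContinuousLinearMap
      { toFun := vec, map_add' := vec_add, map_smul' := fun c A => vec_smul c A }
  have hexp := (hasStrictFDerivAt_exp (L (vecl (matLog C)))).hasFDerivAt
  have h1 := (vecL.hasFDerivAt.comp _ (hexp.comp _ hL)).congr_of_eventuallyEq
    (f₁ := fun γ : BelowDiag n → ℝ => vec (corrOf γ))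
    (by filter_upwards [hev] with γ hγ; rw [hγ]; rfl)
  rw [hL₀] at h1
  convert! h1 using 1
  ext1 h
  exact (vec_fderiv_exp_eq_mMat hC.1 hQ hlog (hd h)).symm

end Param

/-! ### The matrix Ω and the differential of the square root -/

section Omega

variable {n : ℕ}

theorem isUnit_kronSum_matSqrt {C : Matrix (Fin n) (Fin n) ℝ} (hC : C.PosDef) :
    IsUnit (kronSum (matSqrt C) 1) :=
  (posDef_kronSum_one (posDef_matSqrt hC)).isUnit

/-- Ω is a product of two symmetric matrices that commute, both being built from I and powers of
C^{1/2} in the Kronecker factors. -/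
theorem transpose_omegaMat {C : Matrix (Fin n) (Fin n) ℝ} (hC : C.PosDef) :
    (omegaMat C)ᵀ = omegaMat C := by
  have hS := posDef_matSqrt hC
  have hu := (Matrix.isUnit_iff_isUnit_det _).mp hS.isUnit
  have hK := (Matrix.isUnit_iff_isUnit_det _).mp (isUnit_kronSum_matSqrt hC)
  have hSt : (matSqrt C)ᵀ = matSqrt C := by
    have := hS.isHermitian
    rwa [IsHermitian, conjTranspose_eq_transpose_of_trivial] at this
  have hcomm : kronSum (matSqrt C) 1 * ((1 : Matrix (Fin n) (Fin n) ℝ) ⊗ₖ (matSqrt C)⁻¹)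
      = ((1 : Matrix (Fin n) (Fin n) ℝ) ⊗ₖ (matSqrt C)⁻¹) * kronSum (matSqrt C) 1 := by
    rw [kronSum, Matrix.add_mul, Matrix.mul_add, ← mul_kronecker_mul, ← mul_kronecker_mul,
      ← mul_kronecker_mul, ← mul_kronecker_mul, mul_nonsing_inv _ hu, nonsing_inv_mul _ hu]
    simp only [Matrix.one_mul, Matrix.mul_one]
  have hKt : (kronSum (matSqrt C) 1)ᵀ = kronSum (matSqrt C) 1 := by
    rw [kronSum, transpose_add, ← kroneckerMap_transpose, ← kroneckerMap_transpose, hSt,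
      transpose_one]
  rw [omegaMat, transpose_mul, transpose_nonsing_inv, hKt, ← kroneckerMap_transpose,
    transpose_nonsing_inv, hSt, transpose_one]
  calc _ = (kronSum (matSqrt C) 1)⁻¹ * (((1 : Matrix (Fin n) (Fin n) ℝ) ⊗ₖ (matSqrt C)⁻¹)
        * kronSum (matSqrt C) 1) * (kronSum (matSqrt C) 1)⁻¹ := by
        rw [Matrix.mul_assoc, Matrix.mul_assoc, mul_nonsing_inv _ hK, Matrix.mul_one]
    _ = _ := by
        rw [← hcomm, ← Matrix.mul_assoc, nonsing_inv_mul _ hK, Matrix.one_mul]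

/-- The differential of `C^{1/2}`, premultiplied by `C^{-1/2}`, in terms of that of `C`. -/
theorem vec_inv_matSqrt_mul {C S' C' : Matrix (Fin n) (Fin n) ℝ} (hC : C.PosDef)
    (h : S' * matSqrt C + matSqrt C * S' = C') :
    vec ((matSqrt C)⁻¹ * S') = omegaMat C *ᵥ vec C' := by
  have hK := (Matrix.isUnit_iff_isUnit_det _).mp (isUnit_kronSum_matSqrt hC)
  have hSt : (matSqrt C)ᵀ = matSqrt C := by
    have := (posDef_matSqrt hC).isHermitian
    rwa [IsHermitian, conjTranspose_eq_transpose_of_trivial] at this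
  have h1 : kronSum (matSqrt C) 1 *ᵥ vec S' = vec C' := by
    rw [kronSum, add_mulVec, kronecker_mulVec_vec, kronecker_mulVec_vec, ← h, hSt,
      Matrix.one_mul, transpose_one, Matrix.mul_one, vec_add]
  rw [omegaMat, ← h1, mulVec_mulVec, Matrix.mul_assoc, nonsing_inv_mul _ hK, Matrix.mul_one,
    kronecker_mulVec_vec, transpose_one, Matrix.mul_one]

end Omega

/-! ### Differentiability of the log-likelihood and the score -/

section Score

open NormedSpace (exp)
open scoped Matrix.Norms.Operator Topology

variable {n G : ℕ}

/-- The chain rule for one block: with κ = ν_g - 2 and b = ν_g + m_g the factor in front of the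
inner product is W_g. -/
theorem hasFDerivAt_log_one_add_dotProduct {E : Type*} [NormedAddCommGroup E] [NormedSpace ℝ E]
    {k : ℕ} {v : E → Fin k → ℝ} {v' : E →L[ℝ] (Fin k → ℝ)} {x : E} (hv : HasFDerivAt v v' x)
    {κ : ℝ} (hκ : 0 < κ) (a b : ℝ) :
    ∃ F' : E →L[ℝ] ℝ,
      HasFDerivAt (fun y => a - b / 2 * Real.log (1 + (v y ⬝ᵥ v y) / κ)) F' x ∧
      ∀ h, F' h = -(b / (κ + v x ⬝ᵥ v x) * (v x ⬝ᵥ v' h)) := by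
  have hq0 : 0 ≤ v x ⬝ᵥ v x := Finset.sum_nonneg fun i _ => mul_self_nonneg _
  have hi := hasFDerivAt_pi'.mp hv
  have hq : HasFDerivAt (fun y => v y ⬝ᵥ v y) _ x :=
    HasFDerivAt.fun_sum (u := Finset.univ) fun i _ => (hi i).fun_mul (hi i)
  have hpos : (0 : ℝ) < 1 + (v x ⬝ᵥ v x) / κ := by positivity
  refine ⟨_, (((hq.mul_const κ⁻¹).const_add 1).log
    (by simpa [div_eq_mul_inv] using hpos.ne')).const_mul (b / 2) |>.const_sub a, fun h => ?_⟩
  have hs : (∑ i : Fin k, (v x i * v' h i + v x i * v' h i)) = 2 * (v x ⬝ᵥ v' h) := by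
    rw [dotProduct, Finset.mul_sum]
    exact Finset.sum_congr rfl fun i _ => by ring
  have hne : κ + v x ⬝ᵥ v x ≠ 0 := by positivity
  simp only [_root_.neg_apply, _root_.smul_apply, _root_.sum_apply, _root_.add_apply,
    ContinuousLinearMap.comp_apply, ContinuousLinearMap.proj_apply, smul_eq_mul, hs]
  have : (1 + v x ⬝ᵥ v x * κ⁻¹) = (κ + v x ⬝ᵥ v x) / κ := by field_simp
  rw [this]
  field_simp

theorem vec_vecMulVec_dotProduct_vec (a u : Fin n → ℝ) (B : Matrix (Fin n) (Fin n) ℝ) :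
    vec (vecMulVec a u) ⬝ᵥ vec B = a ⬝ᵥ (B *ᵥ u) := by
  rw [vec_dotProduct_vec, transpose_vecMulVec, vecMulVec_mul, trace_vecMulVec,
    dotProduct_comm, ← dotProduct_mulVec]

theorem vec_one_dotProduct_vec (B : Matrix (Fin n) (Fin n) ℝ) :
    vec (1 : Matrix (Fin n) (Fin n) ℝ) ⬝ᵥ vec B = B.trace := by
  rw [vec_dotProduct_vec, transpose_one, Matrix.one_mul]

/-- The bracket in the closed form of the score. -/
def scoreVec {m : Fin G → ℕ} (ν : Fin G → ℝ) (P : Matrix (Fin n) (Σ g, Fin (m g)) ℝ)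
    (C : Matrix (Fin n) (Fin n) ℝ) (z : Fin n → ℝ) : Fin n × Fin n → ℝ :=
  ∑ g, wOf ν P C z g • vec (vecMulVec (colBlock P g *ᵥ vOf P C z g) (uOf C z))
    - vec (1 : Matrix (Fin n) (Fin n) ℝ)

/-- The values c = 1/2, -1/2 and 1 serve C^{1/2}, C^{-1/2} and C. -/
theorem hasFDerivAt_exp_smul_comp {L : (BelowDiag n → ℝ) → Matrix (Fin n) (Fin n) ℝ}
    {L' : (BelowDiag n → ℝ) →L[ℝ] Matrix (Fin n) (Fin n) ℝ} {γ : BelowDiag n → ℝ}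
    (hL : HasFDerivAt L L' γ) (c : ℝ) :
    HasFDerivAt (fun γ => exp (c • L γ)) ((fderiv ℝ exp (c • L γ)).comp (c • L')) γ :=
  (hasStrictFDerivAt_exp _).hasFDerivAt.comp γ (hL.const_smul c)

/-- The product rule, meant for C^{1/2} C^{1/2} = C and for C^{-1/2} C^{1/2} = I. -/
theorem matSqrt_mul_comm_of_hasFDerivAt {S T E : (BelowDiag n → ℝ) → Matrix (Fin n) (Fin n) ℝ}
    {S' T' E' : (BelowDiag n → ℝ) →L[ℝ] Matrix (Fin n) (Fin n) ℝ} {γ : BelowDiag n → ℝ}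
    (hS : HasFDerivAt S S' γ) (hT : HasFDerivAt T T' γ) (hE : HasFDerivAt E E' γ)
    (h : ∀ γ, T γ * S γ = E γ) (v : BelowDiag n → ℝ) :
    T γ * S' v + T' v * S γ = E' v := by
  have h1 := hT.mul' hS
  have h2 : T * S = E := funext h
  rw [h2] at h1
  exact DFunLike.congr_fun (h1.unique hE) v

/-- Near `γ = vecl (log C)`, the log-determinant of `C(γ)` and `C(γ)^{-1/2}` are differentiable. -/
theorem exists_inv_matSqrt_corrOf {C : Matrix (Fin n) (Fin n) ℝ}
    (hC : IsCorrelation C) {Q : Matrix (Fin n) (Fin n) ℝ} {lam : Fin n → ℝ} (hQ : Qᵀ * Q = 1)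
    (hlog : matLog C = Q * diagonal lam * Qᵀ) :
    ∃ (l : (BelowDiag n → ℝ) → ℝ) (l' : (BelowDiag n → ℝ) →L[ℝ] ℝ)
      (T : (BelowDiag n → ℝ) → Matrix (Fin n) (Fin n) ℝ)
      (S' T' : (BelowDiag n → ℝ) →L[ℝ] Matrix (Fin n) (Fin n) ℝ),
      HasFDerivAt l l' (vecl (matLog C)) ∧ HasFDerivAt T T' (vecl (matLog C)) ∧
      (∀ᶠ γ in 𝓝 (vecl (matLog C)),
        Real.log (corrOf γ).det = l γ ∧ (matSqrt (corrOf γ))⁻¹ = T γ) ∧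
      T (vecl (matLog C)) = (matSqrt C)⁻¹ ∧
      (∀ h, T' h = -((matSqrt C)⁻¹ * S' h * (matSqrt C)⁻¹)) ∧
      (∀ h, l' h = 2 * ((matSqrt C)⁻¹ * S' h).trace) ∧
      ∀ h, vec ((matSqrt C)⁻¹ * S' h) = omegaMat C *ᵥ (mMat Q lam *ᵥ h) := by
  obtain ⟨L, x', hL₀, hLs, hL, hev, hd⟩ := exists_log_corrOf hC
  set γ₀ := vecl (matLog C) with hγ₀
  set L' := (symmOf n).comp ((ContinuousLinearMap.id ℝ _).prod x') with hL'
  have hsqrt : ∀ γ, matSqrt (exp (L γ)) = exp ((1 / 2 : ℝ) • L γ) := fun γ => matSqrt_exp (hLs γ)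
  have hTS : ∀ γ, exp ((-(1 / 2) : ℝ) • L γ) = (exp ((1 / 2 : ℝ) • L γ))⁻¹ := fun γ => by
    rw [neg_smul, Matrix.exp_neg]
  have hS₀ : exp ((1 / 2 : ℝ) • L γ₀) = matSqrt C := by rw [← hsqrt, hL₀, exp_matLog hC.1]
  have hSu := (Matrix.isUnit_iff_isUnit_det _).mp (posDef_matSqrt hC.1).isUnit
  have hSS : ∀ γ, exp ((1 / 2 : ℝ) • L γ) * exp ((1 / 2 : ℝ) • L γ) = exp ((1 : ℝ) • L γ) :=
    fun γ => by rw [← hsqrt, matSqrt_mul_self (posDef_exp (hLs γ)), one_smul]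
  have hTS1 : ∀ γ, exp ((-(1 / 2) : ℝ) • L γ) * exp ((1 / 2 : ℝ) • L γ) = 1 := fun γ => by
    have hu := (Matrix.isUnit_iff_isUnit_det _).mp (posDef_matSqrt (posDef_exp (hLs γ))).isUnit
    rw [hTS, ← hsqrt, nonsing_inv_mul _ hu]
  have hdS := hasFDerivAt_exp_smul_comp hL (1 / 2)
  have hdT := hasFDerivAt_exp_smul_comp hL (-(1 / 2))
  have hdC := hasFDerivAt_exp_smul_comp hL 1
  -- The first relation is the Sylvester equation behind Ω; the second gives d(S⁻¹) = -S⁻¹ dS S⁻¹.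
  have hsq := matSqrt_mul_comm_of_hasFDerivAt hdS hdS hdC hSS
  have hone := matSqrt_mul_comm_of_hasFDerivAt hdS hdT (hasFDerivAt_const _ _) hTS1
  -- As S is the exponential of half the logarithm, tr(S⁻¹ dS) is half the trace of the differential
  -- of log C, hence half of d log|C|.
  have htr : ∀ h, ((matSqrt C)⁻¹ * fderiv ℝ exp ((1 / 2 : ℝ) • L γ₀) ((1 / 2 : ℝ) • L' h)).trace
      = 1 / 2 * (L' h).trace := by
    intro h
    have hh : ((1 / 2 : ℝ) • L γ₀).IsHermitian := by
      rw [IsHermitian, conjTranspose_smul, (hLs γ₀).eq, star_trivial]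
    have := trace_exp_neg_mul_fderiv_exp hh ((1 / 2 : ℝ) • L' h)
    rwa [trace_smul, smul_eq_mul, hS₀] at this
  let trL : Matrix (Fin n) (Fin n) ℝ →L[ℝ] ℝ :=
    LinearMap.toContinuousLinearMap (traceLinearMap (Fin n) ℝ ℝ)
  refine ⟨fun γ => (L γ).trace, trL.comp L', _,
    (fderiv ℝ exp ((1 / 2 : ℝ) • L γ₀)).comp ((1 / 2 : ℝ) • L'), _, trL.hasFDerivAt.comp γ₀ hL,
    hdT, ?_, ?_, fun h => ?_, fun h => ?_, fun h => ?_⟩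
  · filter_upwards [hev] with γ hγ
    rw [hγ, hsqrt, hTS]
    exact ⟨log_det_exp (hLs γ), rfl⟩
  · rw [hTS, hS₀]
  · have h3 := hone h
    rw [hTS, hS₀, _root_.zero_apply] at h3
    rw [← Matrix.neg_mul, ← eq_neg_of_add_eq_zero_right h3, Matrix.mul_assoc,
      mul_nonsing_inv _ hSu, Matrix.mul_one]
  · have h3 := htr h
    have h4 : (trL.comp L') h = (L' h).trace := rfl
    rw [h4]
    change _ = 2 * ((matSqrt C)⁻¹ *
      fderiv ℝ exp ((1 / 2 : ℝ) • L γ₀) ((1 / 2 : ℝ) • L' h)).trace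
    rw [h3]
    ring
  · have h3 := hsq h
    rw [add_comm, hS₀] at h3
    rw [vec_inv_matSqrt_mul hC.1 h3, ← vec_fderiv_exp_eq_mMat hC.1 hQ hlog (hd h)]
    simp only [ContinuousLinearMap.comp_apply, one_smul, hL₀]
    rfl

/-- With B = S⁻¹ dS one has dV_g = -P_g' B U. Block g then contributes W_g (P_g V_g)' B U and the
log-determinant contributes -tr B. Both are inner products with vec B = Ω M h. -/
theorem hasFDerivAt_logLikParam (m : Fin G → ℕ) {ν : Fin G → ℝ} (hν : ∀ g, 2 < ν g)
    (P : Matrix (Fin n) (Σ g, Fin (m g)) ℝ) {C : Matrix (Fin n) (Fin n) ℝ}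
    (hC : IsCorrelation C) {Q : Matrix (Fin n) (Fin n) ℝ} {lam : Fin n → ℝ} (hQ : Qᵀ * Q = 1)
    (hlog : matLog C = Q * diagonal lam * Qᵀ) (z : Fin n → ℝ) :
    ∃ F' : (BelowDiag n → ℝ) →L[ℝ] ℝ,
      HasFDerivAt (logLikParam m ν P z) F' (vecl (matLog C)) ∧
      ∀ h, F' h = scoreVec ν P C z ⬝ᵥ (omegaMat C *ᵥ (mMat Q lam *ᵥ h)) := by
  obtain ⟨l, l', T, S', T', hl, hT, hev, hT₀, hT', hl', hM⟩ :=
    exists_inv_matSqrt_corrOf hC hQ hlog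
  have hv : ∀ g, ∃ v' : (BelowDiag n → ℝ) →L[ℝ] (Fin (m g) → ℝ),
      HasFDerivAt (fun γ => (colBlock P g)ᵀ *ᵥ (T γ *ᵥ z)) v' (vecl (matLog C)) ∧
      ∀ h, v' h = (colBlock P g)ᵀ *ᵥ (T' h *ᵥ z) := by
    intro g
    let Λ : Matrix (Fin n) (Fin n) ℝ →L[ℝ] (Fin (m g) → ℝ) := LinearMap.toContinuousLinearMap
      ((colBlock P g)ᵀ.mulVecLin ∘ₗ (Matrix.mulVecBilin ℝ ℝ).flip z)
    exact ⟨Λ.comp T', Λ.hasFDerivAt.comp _ hT, fun h => rfl⟩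
  choose v' hv hv' using hv
  have hsummand := fun g => hasFDerivAt_log_one_add_dotProduct (hv g)
    (sub_pos.mpr (hν g)) (cConst (ν g) (m g)) (ν g + m g)
  choose f' hf hf' using hsummand
  have htotal := (hl.const_mul (-(1 / 2 : ℝ))).fun_add
    (HasFDerivAt.fun_sum (u := Finset.univ) fun g _ => hf g)
  refine ⟨_, htotal.congr_of_eventuallyEq ?_, fun h => ?_⟩
  · filter_upwards [hev] with γ hγ
    simp only [logLikParam, logLik, vOf, uOf, hγ.1, hγ.2]
  · rw [← hM, scoreVec, sub_dotProduct, vec_one_dotProduct_vec, sum_dotProduct]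
    simp only [_root_.add_apply, _root_.sum_apply, _root_.smul_apply, smul_eq_mul, hf', hv', hl']
    rw [add_comm, sub_eq_add_neg]
    congr 1
    · refine Finset.sum_congr rfl fun g _ => ?_
      have hvg : (colBlock P g)ᵀ *ᵥ (T (vecl (matLog C)) *ᵥ z) = vOf P C z g := by
        rw [hT₀]; rfl
      rw [hvg, smul_dotProduct, vec_vecMulVec_dotProduct_vec, smul_eq_mul, wOf, ← mul_neg]
      congr 1
      rw [hT', neg_mulVec, mulVec_neg, dotProduct_neg, neg_neg, ← mulVec_mulVec z,
        dotProduct_mulVec, vecMul_transpose]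
      rfl
    · ring

theorem differentiableAt_logLikParam (m : Fin G → ℕ) {ν : Fin G → ℝ} (hν : ∀ g, 2 < ν g)
    (P : Matrix (Fin n) (Σ g, Fin (m g)) ℝ) {C : Matrix (Fin n) (Fin n) ℝ}
    (hC : IsCorrelation C) (z : Fin n → ℝ) :
    DifferentiableAt ℝ (logLikParam m ν P z) (vecl (matLog C)) := by
  obtain ⟨Q, hQ, hlog, -⟩ := exists_conj_diagonal (isHermitian_matLog hC.1)
  obtain ⟨F', hF, -⟩ := hasFDerivAt_logLikParam m hν P hC hQ hlog z
  exact hF.differentiableAt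

theorem score_eq (m : Fin G → ℕ) {ν : Fin G → ℝ} (hν : ∀ g, 2 < ν g)
    (P : Matrix (Fin n) (Σ g, Fin (m g)) ℝ) {C : Matrix (Fin n) (Fin n) ℝ}
    (hC : IsCorrelation C) {Q : Matrix (Fin n) (Fin n) ℝ} {lam : Fin n → ℝ} (hQ : Qᵀ * Q = 1)
    (hlog : matLog C = Q * diagonal lam * Qᵀ) (z : Fin n → ℝ) :
    score m ν P (vecl (matLog C)) z = ((mMat Q lam)ᵀ * omegaMat C) *ᵥ scoreVec ν P C z := by
  obtain ⟨F', hF, hF'⟩ := hasFDerivAt_logLikParam m hν P hC hQ hlog z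
  ext a
  rw [score, hF.fderiv, hF', mulVec_mulVec, dotProduct_mulVec, ← mulVec_transpose, transpose_mul,
    transpose_omegaMat hC.1, dotProduct_single_one]

end Score

/-! ### Moments of the t kernel by Gamma mixing -/

section GammaMixture

open Real (Gamma)

/-- A function that is not integrable has integral zero by convention, so a closed form with a
positive value already proves integrability. -/
theorem integrable_of_integral_pos {α : Type*} [MeasurableSpace α] {μ : Measure α} {f : α → ℝ}
    (h : 0 < ∫ x, f x ∂μ) : Integrable f μ :=
  not_imp_comm.mp integral_undef h.ne'

theorem lintegral_rpow_mul_exp_neg_mul_Ioi {a r : ℝ} (ha : 0 < a) (hr : 0 < r) :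
    ∫⁻ s in Set.Ioi (0 : ℝ), ENNReal.ofReal (s ^ (a - 1) * Real.exp (-(r * s)))
      = ENNReal.ofReal ((1 / r) ^ a * Gamma a) := by
  have h := Real.integral_rpow_mul_exp_neg_mul_Ioi ha hr
  have hpos : 0 < (1 / r) ^ a * Gamma a :=
    mul_pos (Real.rpow_pos_of_pos (by positivity) _) (Real.Gamma_pos_of_pos ha)
  rw [← h, ofReal_integral_eq_lintegral_ofReal (integrable_of_integral_pos (h ▸ hpos))]
  exact (ae_restrict_mem measurableSet_Ioi).mono fun s hs =>
    mul_nonneg (Real.rpow_nonneg (le_of_lt hs) _) (Real.exp_pos _).le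

theorem integral_pow_mul_exp_neg_mul_sq {a : ℝ} (ha : 0 < a) (e : ℕ) :
    ∫ x : ℝ, x ^ (2 * e) * Real.exp (-(a * x ^ 2))
      = a ^ (-((e : ℝ) + 1 / 2)) * Gamma (e + 1 / 2) := by
  have h1 : ∀ x : ℝ, x ^ (2 * e) * Real.exp (-(a * x ^ 2))
      = (fun y : ℝ => y ^ (2 * e) * Real.exp (-(a * y ^ 2))) |x| := fun x => by
    simp only [sq_abs, pow_mul]
  rw [integral_congr_ae (Filter.Eventually.of_forall h1),
    integral_comp_abs (f := fun y : ℝ => y ^ (2 * e) * Real.exp (-(a * y ^ 2)))]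
  have h2 := integral_rpow_mul_exp_neg_mul_rpow (p := 2) (q := 2 * (e : ℝ)) (b := a) two_pos
    (by have : (0 : ℝ) ≤ e := e.cast_nonneg
        linarith) ha
  have h3 : ∫ y in Set.Ioi (0 : ℝ), y ^ (2 * e) * Real.exp (-(a * y ^ 2))
      = ∫ x in Set.Ioi (0 : ℝ), x ^ (2 * (e : ℝ)) * Real.exp (-a * x ^ (2 : ℝ)) := by
    refine setIntegral_congr_fun measurableSet_Ioi fun x _ => ?_
    have : (2 * (e : ℝ)) = ((2 * e : ℕ) : ℝ) := by push_cast; ring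
    simp only [this, Real.rpow_natCast, Real.rpow_two, neg_mul]
  rw [h3, h2]
  have h4 : (2 * (e : ℝ) + 1) / 2 = e + 1 / 2 := by ring
  have h5 : -(2 * (e : ℝ) + 1) / 2 = -((e : ℝ) + 1 / 2) := by ring
  rw [h4, h5]
  ring

variable {k : ℕ}

theorem dotProduct_self_nonneg' (v : Fin k → ℝ) : 0 ≤ v ⬝ᵥ v :=
  Finset.sum_nonneg fun _ _ => mul_self_nonneg _

theorem lintegral_prod_pow_mul_exp {a : ℝ} (ha : 0 < a) (e : Fin k → ℕ) :
    ∫⁻ v : Fin k → ℝ, ENNReal.ofReal ((∏ i, v i ^ (2 * e i)) * Real.exp (-(a * (v ⬝ᵥ v))))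
      = ENNReal.ofReal (a ^ (-(∑ i, ((e i : ℝ) + 1 / 2))) * ∏ i, Gamma (e i + 1 / 2)) := by
  have h1 : ∀ v : Fin k → ℝ, (∏ i, v i ^ (2 * e i)) * Real.exp (-(a * (v ⬝ᵥ v)))
      = ∏ i, (v i ^ (2 * e i) * Real.exp (-(a * v i ^ 2))) := fun v => by
    rw [Finset.prod_mul_distrib, ← Real.exp_sum, dotProduct, Finset.mul_sum,
      Finset.sum_neg_distrib]
    simp only [sq]
  have h2 : ∫ v : Fin k → ℝ, ∏ i, (v i ^ (2 * e i) * Real.exp (-(a * v i ^ 2)))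
      = a ^ (-(∑ i, ((e i : ℝ) + 1 / 2))) * ∏ i, Gamma (e i + 1 / 2) := by
    rw [integral_fintype_prod_volume_eq_prod
      (fun i (x : ℝ) => x ^ (2 * e i) * Real.exp (-(a * x ^ 2)))]
    simp_rw [integral_pow_mul_exp_neg_mul_sq ha]
    rw [Finset.prod_mul_distrib, ← Finset.sum_neg_distrib, ← Real.rpow_sum_of_pos ha]
  have hpos : 0 < a ^ (-(∑ i, ((e i : ℝ) + 1 / 2))) * ∏ i, Gamma (e i + 1 / 2) :=
    mul_pos (Real.rpow_pos_of_pos ha _)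
      (Finset.prod_pos fun i _ => Real.Gamma_pos_of_pos (by positivity))
  simp_rw [h1]
  rw [← h2, ofReal_integral_eq_lintegral_ofReal (integrable_of_integral_pos (h2 ▸ hpos))]
  exact Filter.Eventually.of_forall fun v => Finset.prod_nonneg fun i _ =>
    mul_nonneg (by rw [pow_mul]; positivity) (Real.exp_pos _).le

/-- Even moments of the multivariate t kernel, by writing it as a Gamma mixture of Gaussians. -/
theorem lintegral_prod_pow_mul_rpow {κ : ℝ} (hκ : 0 < κ) (e : Fin k → ℕ) {b : ℝ}
    (hb : ∑ i, ((e i : ℝ) + 1 / 2) < b) :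
    ∫⁻ v : Fin k → ℝ, ENNReal.ofReal ((∏ i, v i ^ (2 * e i)) * (1 + (v ⬝ᵥ v) / κ) ^ (-b))
      = ENNReal.ofReal (κ ^ (∑ i, ((e i : ℝ) + 1 / 2)) * (∏ i, Gamma (e i + 1 / 2))
        * Gamma (b - ∑ i, ((e i : ℝ) + 1 / 2)) / Gamma b) := by
  set N := ∑ i, ((e i : ℝ) + 1 / 2) with hN
  have hN0 : 0 ≤ N := Finset.sum_nonneg fun i _ => by positivity
  have hb0 : 0 < b := hN0.trans_lt hb
  have hΓ := Real.Gamma_pos_of_pos hb0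
  have hprod : ∀ v : Fin k → ℝ, 0 ≤ ∏ i, v i ^ (2 * e i) := fun v =>
    Finset.prod_nonneg fun i _ => by rw [pow_mul]; positivity
  have hq : ∀ v : Fin k → ℝ, 0 < 1 + (v ⬝ᵥ v) / κ := fun v => by
    have := dotProduct_self_nonneg' v
    positivity
  have hmeas : Measurable fun p : (Fin k → ℝ) × ℝ => ENNReal.ofReal ((∏ i, p.1 i ^ (2 * e i))
      * (p.2 ^ (b - 1) * Real.exp (-((1 + (p.1 ⬝ᵥ p.1) / κ) * p.2)))) := by
    simp only [dotProduct]
    fun_prop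
  -- Tonelli for q^{-b} Γ(b) = ∫ s^{b-1} e^{-qs} ds with q = 1 + v'v/κ. Nonnegative integrals
  -- require no prior integrability.
  have hswap := lintegral_lintegral_swap (μ := (volume : Measure (Fin k → ℝ)))
    (ν := volume.restrict (Set.Ioi (0 : ℝ)))
    (f := fun v s => ENNReal.ofReal ((∏ i, v i ^ (2 * e i))
      * (s ^ (b - 1) * Real.exp (-((1 + (v ⬝ᵥ v) / κ) * s))))) hmeas.aemeasurable
  have hL : ∀ v : Fin k → ℝ, ∫⁻ s in Set.Ioi (0 : ℝ), ENNReal.ofReal ((∏ i, v i ^ (2 * e i))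
      * (s ^ (b - 1) * Real.exp (-((1 + (v ⬝ᵥ v) / κ) * s))))
      = ENNReal.ofReal (Gamma b)
        * ENNReal.ofReal ((∏ i, v i ^ (2 * e i)) * (1 + (v ⬝ᵥ v) / κ) ^ (-b)) := fun v => by
    simp_rw [ENNReal.ofReal_mul (hprod v)]
    rw [lintegral_const_mul' _ _ ENNReal.ofReal_ne_top,
      lintegral_rpow_mul_exp_neg_mul_Ioi hb0 (hq v), mul_comm ((1 / _) ^ b),
      ENNReal.ofReal_mul hΓ.le, one_div, Real.inv_rpow (hq v).le, ← Real.rpow_neg (hq v).le]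
    ring
  -- For fixed s the v-integral is Gaussian with rate s/κ and yields κ^N s^{-N}. What remains in s
  -- is the integral for Γ(b - N), which converges because N < b.
  have hR : ∀ s ∈ Set.Ioi (0 : ℝ), ∫⁻ v : Fin k → ℝ, ENNReal.ofReal ((∏ i, v i ^ (2 * e i))
      * (s ^ (b - 1) * Real.exp (-((1 + (v ⬝ᵥ v) / κ) * s))))
      = ENNReal.ofReal (κ ^ N * ∏ i, Gamma (e i + 1 / 2))
        * ENNReal.ofReal (s ^ (b - N - 1) * Real.exp (-(1 * s))) := by
    intro s hs
    have hs : 0 < s := hs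
    have hsκ : 0 < s / κ := by positivity
    have h1 : ∀ v : Fin k → ℝ, (∏ i, v i ^ (2 * e i))
        * (s ^ (b - 1) * Real.exp (-((1 + (v ⬝ᵥ v) / κ) * s)))
        = (s ^ (b - 1) * Real.exp (-s))
          * ((∏ i, v i ^ (2 * e i)) * Real.exp (-(s / κ * (v ⬝ᵥ v)))) := fun v => by
      have : -((1 + (v ⬝ᵥ v) / κ) * s) = -s + -(s / κ * (v ⬝ᵥ v)) := by ring
      rw [this, Real.exp_add]
      ring
    have hc : 0 ≤ s ^ (b - 1) * Real.exp (-s) := by positivity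
    simp_rw [h1, ENNReal.ofReal_mul hc]
    rw [lintegral_const_mul' _ _ ENNReal.ofReal_ne_top, lintegral_prod_pow_mul_exp hsκ, ← hN,
      ← ENNReal.ofReal_mul hc, ← ENNReal.ofReal_mul]
    · congr 1
      rw [Real.div_rpow hs.le hκ.le, Real.rpow_neg hκ.le, div_inv_eq_mul, one_mul]
      have : b - N - 1 = (b - 1) + -N := by ring
      rw [this, Real.rpow_add hs]
      ring
    · exact mul_nonneg (by positivity)
        (Finset.prod_nonneg fun i _ => (Real.Gamma_pos_of_pos (by positivity)).le)
  simp_rw [hL] at hswap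
  rw [setLIntegral_congr_fun measurableSet_Ioi hR,
    lintegral_const_mul' _ _ ENNReal.ofReal_ne_top, lintegral_const_mul' _ _ ENNReal.ofReal_ne_top,
    lintegral_rpow_mul_exp_neg_mul_Ioi (sub_pos.mpr hb) one_pos] at hswap
  have hc : 0 ≤ κ ^ N * ∏ i, Gamma (e i + 1 / 2) := mul_nonneg (by positivity)
    (Finset.prod_nonneg fun i _ => (Real.Gamma_pos_of_pos (by positivity)).le)
  rw [← ENNReal.ofReal_mul hc] at hswap
  rw [ENNReal.ofReal_div_of_pos hΓ, ENNReal.eq_div_iff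
    (ENNReal.ofReal_pos.mpr hΓ).ne' ENNReal.ofReal_ne_top, hswap]
  simp

theorem integrable_prod_pow_mul_rpow {κ : ℝ} (hκ : 0 < κ) (e : Fin k → ℕ) {b : ℝ}
    (hb : ∑ i, ((e i : ℝ) + 1 / 2) < b) :
    Integrable (fun v : Fin k → ℝ => (∏ i, v i ^ (2 * e i)) * (1 + (v ⬝ᵥ v) / κ) ^ (-b)) ∧
    ∫ v : Fin k → ℝ, (∏ i, v i ^ (2 * e i)) * (1 + (v ⬝ᵥ v) / κ) ^ (-b)
      = κ ^ (∑ i, ((e i : ℝ) + 1 / 2)) * (∏ i, Gamma (e i + 1 / 2))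
        * Gamma (b - ∑ i, ((e i : ℝ) + 1 / 2)) / Gamma b := by
  have h := lintegral_prod_pow_mul_rpow hκ e hb
  have hN0 : 0 ≤ ∑ i, ((e i : ℝ) + 1 / 2) := Finset.sum_nonneg fun i _ => by positivity
  have hnn : ∀ v : Fin k → ℝ, 0 ≤ (∏ i, v i ^ (2 * e i)) * (1 + (v ⬝ᵥ v) / κ) ^ (-b) := fun v => by
    have := dotProduct_self_nonneg' v
    exact mul_nonneg (Finset.prod_nonneg fun i _ => by rw [pow_mul]; positivity) (by positivity)
  have hmeas : Measurable fun v : Fin k → ℝ =>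
      (∏ i, v i ^ (2 * e i)) * (1 + (v ⬝ᵥ v) / κ) ^ (-b) := by
    simp only [dotProduct]
    fun_prop
  constructor
  · refine ⟨hmeas.aestronglyMeasurable, ?_⟩
    rw [hasFiniteIntegral_iff_ofReal (Filter.Eventually.of_forall hnn), h]
    exact ENNReal.ofReal_lt_top
  · rw [integral_eq_lintegral_of_nonneg_ae (Filter.Eventually.of_forall hnn)
      hmeas.aestronglyMeasurable, h, ENNReal.toReal_ofReal]
    have h1 := Real.Gamma_pos_of_pos (sub_pos.mpr hb)
    have h2 := Real.Gamma_pos_of_pos (hN0.trans_lt hb)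
    have h3 : 0 ≤ ∏ i, Gamma ((e i : ℝ) + 1 / 2) :=
      Finset.prod_nonneg fun i _ => (Real.Gamma_pos_of_pos (by positivity)).le
    positivity

end GammaMixture

/-! ### Moments of the standardized t-distribution -/

section TStd

open Real (Gamma)

variable {k : ℕ} {ν : ℝ}

theorem measurable_tStdDensity (k : ℕ) (ν : ℝ) : Measurable (tStdDensity k ν) := by
  unfold tStdDensity
  simp only [dotProduct]
  fun_prop

theorem tStdDensity_pos (hν : 2 < ν) (v : Fin k → ℝ) : 0 < tStdDensity k ν v := by
  have h1 := Real.Gamma_pos_of_pos (show 0 < (ν + k) / 2 by positivity)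
  have h2 := Real.Gamma_pos_of_pos (show 0 < ν / 2 by linarith)
  have h3 := dotProduct_self_nonneg' v
  have h4 : 0 < ν - 2 := sub_pos.mpr hν
  have h5 := Real.pi_pos
  unfold tStdDensity
  positivity

theorem integrable_tStd_iff (hν : 2 < ν) {f : (Fin k → ℝ) → ℝ} :
    Integrable f (tStd k ν) ↔ Integrable (fun v => tStdDensity k ν v * f v) := by
  rw [tStd, integrable_withDensity_iff_integrable_smul'
    (measurable_tStdDensity k ν).ennreal_ofReal (by simp)]
  simp only [ENNReal.toReal_ofReal (tStdDensity_pos hν _).le, smul_eq_mul]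

theorem integral_tStd (hν : 2 < ν) (f : (Fin k → ℝ) → ℝ) :
    ∫ v, f v ∂(tStd k ν) = ∫ v, tStdDensity k ν v * f v := by
  rw [tStd, integral_withDensity_eq_integral_toReal_smul
    (measurable_tStdDensity k ν).ennreal_ofReal (by simp)]
  simp only [ENNReal.toReal_ofReal (tStdDensity_pos hν _).le, smul_eq_mul]

/-- The weight `(ν + k) / (ν - 2 + v'v)`. -/
def tWeight (ν : ℝ) (v : Fin k → ℝ) : ℝ := (ν + k) / (ν - 2 + v ⬝ᵥ v)

/-- Mixed moments of the weight and the even monomials under the standardized t-distribution. -/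
theorem tStd_moment (hν : 2 < ν) (j : ℕ) (e : Fin k → ℕ) (he : ∑ i, (e i : ℝ) < ν / 2 + j) :
    Integrable (fun v => tWeight ν v ^ j * ∏ i, v i ^ (2 * e i)) (tStd k ν) ∧
    ∫ v, tWeight ν v ^ j * ∏ i, v i ^ (2 * e i) ∂(tStd k ν)
      = ((ν + k) / (ν - 2)) ^ j * (ν - 2) ^ (∑ i, e i)
        * (∏ i, Gamma (e i + 1 / 2) / √Real.pi)
        * (Gamma (ν / 2 + j - ∑ i, (e i : ℝ)) / Gamma (ν / 2))
        * (Gamma ((ν + k) / 2) / Gamma ((ν + k) / 2 + j)) := by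
  have hκ : 0 < ν - 2 := sub_pos.mpr hν
  have hN : ∑ i : Fin k, ((e i : ℝ) + 1 / 2) = ∑ i, (e i : ℝ) + k / 2 := by
    rw [Finset.sum_add_distrib]
    simp
    ring
  have hb : ∑ i : Fin k, ((e i : ℝ) + 1 / 2) < (ν + k) / 2 + j := by
    rw [hN]
    linarith
  obtain ⟨h1, h2⟩ := integrable_prod_pow_mul_rpow hκ e hb
  -- Each weight is a constant times (1 + v'v/(ν - 2))⁻¹, so `j` weights only raise the exponent of
  -- the kernel by `j`.
  have hpt : ∀ v : Fin k → ℝ, tStdDensity k ν v * (tWeight ν v ^ j * ∏ i, v i ^ (2 * e i))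
      = (Gamma ((ν + k) / 2) / Gamma (ν / 2) * ((ν - 2) * Real.pi) ^ (-(k : ℝ) / 2)
          * ((ν + k) / (ν - 2)) ^ j)
        * ((∏ i, v i ^ (2 * e i)) * (1 + (v ⬝ᵥ v) / (ν - 2)) ^ (-((ν + k) / 2 + j))) := by
    intro v
    have hv := dotProduct_self_nonneg' v
    have hq : 0 < 1 + (v ⬝ᵥ v) / (ν - 2) := by positivity
    have hw : tWeight ν v = (ν + k) / (ν - 2) * (1 + (v ⬝ᵥ v) / (ν - 2))⁻¹ := by
      unfold tWeight
      have : 0 < ν - 2 + v ⬝ᵥ v := by positivity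
      field_simp
    have he1 : -(ν + k) / 2 = -((ν + k) / 2) := by ring
    have he2 : -((ν + k) / 2 + j) = -((ν + k) / 2) + -(j : ℝ) := by ring
    rw [hw, tStdDensity, mul_pow, he1, he2, Real.rpow_add hq, Real.rpow_neg hq.le (j : ℝ),
      Real.rpow_natCast, inv_pow]
    ring
  constructor
  · rw [integrable_tStd_iff hν]
    simp_rw [hpt]
    exact h1.const_mul _
  · rw [integral_tStd hν]
    simp_rw [hpt]
    rw [integral_const_mul, h2, hN, Finset.prod_div_distrib]
    have hπ := Real.pi_pos
    have hg : (ν + k) / 2 + j - (∑ i, (e i : ℝ) + k / 2) = ν / 2 + j - ∑ i, (e i : ℝ) := by ring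
    have hk : ((ν - 2) * Real.pi) ^ (-(k : ℝ) / 2)
        = ((ν - 2) ^ ((k : ℝ) / 2))⁻¹ * (√Real.pi ^ k)⁻¹ := by
      rw [Real.mul_rpow hκ.le hπ.le, neg_div, Real.rpow_neg hκ.le, Real.rpow_neg hπ.le]
      congr 2
      rw [Real.sqrt_eq_rpow, ← Real.rpow_mul_natCast hπ.le]
      congr 1
      ring
    have hs : (ν - 2) ^ (∑ i, (e i : ℝ) + k / 2)
        = (ν - 2) ^ (∑ i, e i) * (ν - 2) ^ ((k : ℝ) / 2) := by
      rw [Real.rpow_add hκ, ← Nat.cast_sum, Real.rpow_natCast]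
    have hne : (ν - 2) ^ ((k : ℝ) / 2) ≠ 0 := (Real.rpow_pos_of_pos hκ _).ne'
    rw [hg, hk, hs, Finset.prod_const, Finset.card_univ, Fintype.card_fin]
    field_simp

theorem isProbabilityMeasure_tStd (hν : 2 < ν) : IsProbabilityMeasure (tStd k ν) := by
  obtain ⟨h1, h2⟩ := tStd_moment (k := k) hν 0 0 (by simp; linarith)
  have hΓ := Real.Gamma_pos_of_pos (show 0 < (ν + k) / 2 by positivity)
  have hΓ' := Real.Gamma_pos_of_pos (show 0 < ν / 2 by linarith)
  have hπ := Real.sqrt_pos.mpr Real.pi_pos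
  simp only [pow_zero, Pi.zero_apply, mul_zero, Finset.prod_const_one, mul_one, integral_const,
    smul_eq_mul, Finset.sum_const_zero, Nat.cast_zero, zero_add, Real.Gamma_one_half_eq, sub_zero,
    add_zero, div_self hΓ.ne', div_self hΓ'.ne', div_self hπ.ne'] at h2
  exact ⟨by rwa [measureReal_def, ENNReal.toReal_eq_one_iff] at h2⟩

theorem gamma_three_halves : Gamma (1 + 1 / 2) = √Real.pi / 2 := by
  rw [add_comm, Real.Gamma_add_one (by norm_num), Real.Gamma_one_half_eq]
  ring

theorem gamma_five_halves : Gamma (2 + 1 / 2) = 3 * √Real.pi / 4 := by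
  have : (2 + 1 / 2 : ℝ) = (1 + 1 / 2) + 1 := by norm_num
  rw [this, Real.Gamma_add_one (by norm_num), gamma_three_halves]
  ring

theorem prod_pow_single (v : Fin k → ℝ) (a : Fin k) (c : ℕ) :
    ∏ i, v i ^ (2 * (Pi.single a c : Fin k → ℕ) i) = v a ^ (2 * c) := by
  rw [Finset.prod_eq_single a] <;> simp +contextual

theorem prod_gamma_single (a : Fin k) (c : ℕ) :
    ∏ i, Gamma (((Pi.single a c : Fin k → ℕ) i : ℝ) + 1 / 2) / √Real.pi
      = Gamma (c + 1 / 2) / √Real.pi := by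
  have hπ := Real.sqrt_pos.mpr Real.pi_pos
  rw [Finset.prod_eq_single a]
  · simp
  · intro b _ hb
    rw [Pi.single_eq_of_ne hb, Nat.cast_zero, zero_add, Real.Gamma_one_half_eq, div_self hπ.ne']
  · simp

theorem tStd_moment_single (hν : 2 < ν) (j : ℕ) (a : Fin k) (c : ℕ) (hc : (c : ℝ) < ν / 2 + j) :
    Integrable (fun v => tWeight ν v ^ j * v a ^ (2 * c)) (tStd k ν) ∧
    ∫ v, tWeight ν v ^ j * v a ^ (2 * c) ∂(tStd k ν)
      = ((ν + k) / (ν - 2)) ^ j * (ν - 2) ^ c * (Gamma (c + 1 / 2) / √Real.pi)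
        * (Gamma (ν / 2 + j - c) / Gamma (ν / 2))
        * (Gamma ((ν + k) / 2) / Gamma ((ν + k) / 2 + j)) := by
  have hs : ∑ i, ((Pi.single a c : Fin k → ℕ) i : ℝ) = c := by
    rw [← Nat.cast_sum, Finset.sum_pi_single']
    simp
  have hs' : ∑ i, (Pi.single a c : Fin k → ℕ) i = c := by
    rw [Finset.sum_pi_single']
    simp
  have := tStd_moment hν j (Pi.single a c) (by rw [hs]; exact hc)
  simpa only [prod_pow_single, prod_gamma_single, hs, hs'] using this

theorem integrable_sq_tStd (hν : 2 < ν) (a : Fin k) :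
    Integrable (fun v => v a ^ 2) (tStd k ν) := by
  simpa using (tStd_moment_single hν 0 a 1 (by push_cast; linarith)).1

/-- The scale ν - 2 is chosen for this: Γ(ν/2 - 1)/Γ(ν/2) = 2/(ν - 2) cancels (ν - 2)/2. -/
theorem integral_sq_tStd (hν : 2 < ν) (a : Fin k) : ∫ v, v a ^ 2 ∂(tStd k ν) = 1 := by
  have h := (tStd_moment_single hν 0 a 1 (by push_cast; linarith)).2
  have hΓ := Real.Gamma_pos_of_pos (show 0 < (ν + k) / 2 by positivity)
  have hΓ' := Real.Gamma_pos_of_pos (show 0 < ν / 2 - 1 by linarith)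
  have hg : Gamma (ν / 2) = (ν / 2 - 1) * Gamma (ν / 2 - 1) := by
    rw [← Real.Gamma_add_one (by linarith)]
    congr 1
    ring
  have hπ := Real.sqrt_pos.mpr Real.pi_pos
  have h1 : ν - 2 ≠ 0 := (sub_pos.mpr hν).ne'
  simp only [pow_zero, one_mul, mul_one, pow_one, Nat.cast_one, Nat.cast_zero, add_zero,
    gamma_three_halves, hg] at h
  have h2 : ν / 2 - 1 = (ν - 2) / 2 := by ring
  rw [h]
  generalize Gamma (ν / 2 - 1) = x at hΓ'
  rw [h2]
  field_simp

/-- Responsible for the zero mean of the bracket in the score. -/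
theorem integral_weight_mul_sq_tStd (hν : 2 < ν) (a : Fin k) :
    ∫ v, tWeight ν v * v a ^ 2 ∂(tStd k ν) = 1 := by
  have h := (tStd_moment_single hν 1 a 1 (by push_cast; linarith)).2
  have hΓ := Real.Gamma_pos_of_pos (show 0 < (ν + k) / 2 by positivity)
  have hΓ' := Real.Gamma_pos_of_pos (show 0 < ν / 2 by linarith)
  have hπ := Real.sqrt_pos.mpr Real.pi_pos
  have h1 : ν - 2 ≠ 0 := (sub_pos.mpr hν).ne'
  have h2 : 0 < ν + k := by positivity
  simp only [pow_one, mul_one, Nat.cast_one, gamma_three_halves, add_sub_cancel_right,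
    Real.Gamma_add_one (show (ν + k) / 2 ≠ 0 by positivity)] at h
  rw [h]
  field_simp

theorem gamma_add_two {x : ℝ} (hx : 0 < x) : Gamma (x + 2) = (x + 1) * (x * Gamma x) := by
  have : x + 2 = (x + 1) + 1 := by ring
  rw [this, Real.Gamma_add_one (by positivity), Real.Gamma_add_one hx.ne']

theorem integral_weight_sq_mul_sq_tStd (hν : 2 < ν) (a : Fin k) :
    ∫ v, tWeight ν v ^ 2 * v a ^ 2 ∂(tStd k ν) = psiConst ν k := by
  have h := (tStd_moment_single hν 2 a 1 (by push_cast; linarith)).2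
  have hΓ := Real.Gamma_pos_of_pos (show 0 < (ν + k) / 2 by positivity)
  have hν2 : 0 < ν / 2 := by linarith
  have hΓ' := Real.Gamma_pos_of_pos hν2
  have hπ := Real.sqrt_pos.mpr Real.pi_pos
  have h1 : ν - 2 ≠ 0 := (sub_pos.mpr hν).ne'
  have h2 : 0 < ν + k := by positivity
  have h3 : ν / 2 + (2 : ℕ) - (1 : ℕ) = ν / 2 + 1 := by push_cast; ring
  have h4 : (ν + k) / 2 + 1 = (ν + k + 2) / 2 := by ring
  simp only [mul_one, h3] at h
  simp only [pow_one, Nat.cast_one, Nat.cast_ofNat, gamma_three_halves,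
    Real.Gamma_add_one hν2.ne', gamma_add_two (show 0 < (ν + k) / 2 by positivity), h4] at h
  rw [h, psiConst, phiConst]
  field_simp

/-- Γ(5/2) = 3√π/4 against Γ(3/2)² = π/4 gives the Gaussian ratio 3 : 1 to the mixed moment of two
distinct coordinates. Hence all fourth moments in a block are φ times those of a standard Gaussian.
-/
theorem integral_weight_sq_mul_pow_four_tStd (hν : 2 < ν) (a : Fin k) :
    ∫ v, tWeight ν v ^ 2 * v a ^ 4 ∂(tStd k ν) = 3 * phiConst ν k := by
  have h := (tStd_moment_single hν 2 a 2 (by push_cast; linarith)).2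
  have hΓ := Real.Gamma_pos_of_pos (show 0 < (ν + k) / 2 by positivity)
  have hν2 : 0 < ν / 2 := by linarith
  have hΓ' := Real.Gamma_pos_of_pos hν2
  have hπ := Real.sqrt_pos.mpr Real.pi_pos
  have h1 : ν - 2 ≠ 0 := (sub_pos.mpr hν).ne'
  have h2 : 0 < ν + k := by positivity
  have h4 : (ν + k) / 2 + 1 = (ν + k + 2) / 2 := by ring
  simp only [Nat.reduceMul, Nat.cast_ofNat, gamma_five_halves, add_sub_cancel_right,
    gamma_add_two (show 0 < (ν + k) / 2 by positivity), h4] at h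
  rw [h, phiConst]
  field_simp
  norm_num

theorem integral_weight_sq_mul_sq_mul_sq_tStd (hν : 2 < ν) {a b : Fin k} (hab : a ≠ b) :
    ∫ v, tWeight ν v ^ 2 * (v a ^ 2 * v b ^ 2) ∂(tStd k ν) = phiConst ν k := by
  set e : Fin k → ℕ := Pi.single a 1 + Pi.single b 1 with he
  have hΓ := Real.Gamma_pos_of_pos (show 0 < (ν + k) / 2 by positivity)
  have hν2 : 0 < ν / 2 := by linarith
  have hΓ' := Real.Gamma_pos_of_pos hν2
  have hπ := Real.sqrt_pos.mpr Real.pi_pos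
  have hs' : ∑ i, e i = 2 := by
    simp [he, Finset.sum_add_distrib]
  have hs : ∑ i, (e i : ℝ) = 2 := by
    rw [← Nat.cast_sum, hs', Nat.cast_ofNat]
  have hp : ∀ v : Fin k → ℝ, ∏ i, v i ^ (2 * e i) = v a ^ 2 * v b ^ 2 := fun v => by
    simp only [he, Pi.add_apply, mul_add, pow_add, Finset.prod_mul_distrib, prod_pow_single,
      mul_one]
  -- Each of the two squared coordinates contributes Γ(3/2)/√π = 1/2, every other one contributes 1.
  have hg : ∏ i, Gamma ((e i : ℝ) + 1 / 2) / √Real.pi = 1 / 4 := by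
    have : ∀ i, Gamma ((e i : ℝ) + 1 / 2) / √Real.pi
        = (if i = a then 1 / 2 else 1) * (if i = b then 1 / 2 else 1) := fun i => by
      rcases eq_or_ne i a with rfl | ha
      · rw [if_pos rfl, if_neg hab, he, Pi.add_apply, Pi.single_eq_same,
          Pi.single_eq_of_ne hab, add_zero, Nat.cast_one, gamma_three_halves]
        field_simp
      · rcases eq_or_ne i b with rfl | hb
        · rw [if_neg ha, if_pos rfl, he, Pi.add_apply, Pi.single_eq_same,
            Pi.single_eq_of_ne ha, zero_add, Nat.cast_one, gamma_three_halves]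
          field_simp
        · rw [if_neg ha, if_neg hb, he, Pi.add_apply, Pi.single_eq_of_ne ha,
            Pi.single_eq_of_ne hb, add_zero, Nat.cast_zero, zero_add, Real.Gamma_one_half_eq,
            div_self hπ.ne', one_mul]
    simp_rw [this]
    rw [Finset.prod_mul_distrib, Finset.prod_ite_eq', Finset.prod_ite_eq']
    norm_num
  have h := (tStd_moment hν 2 e (by rw [hs]; push_cast; linarith)).2
  have h1 : ν - 2 ≠ 0 := (sub_pos.mpr hν).ne'
  have h2 : 0 < ν + k := by positivity
  have h4 : (ν + k) / 2 + 1 = (ν + k + 2) / 2 := by ring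
  simp only [hp, hs, hs', hg, Nat.cast_ofNat, add_sub_cancel_right,
    gamma_add_two (show 0 < (ν + k) / 2 by positivity), h4] at h
  rw [h, phiConst]
  field_simp
  norm_num

end TStd

/-! ### The density of the convolution-t distribution -/

section Density

theorem pi_withDensity_ofReal {ι : Type*} [Fintype ι] {α : ι → Type*}
    [∀ i, MeasurableSpace (α i)] (μ : ∀ i, Measure (α i)) [∀ i, SigmaFinite (μ i)]
    {f : ∀ i, α i → ℝ} (hf : ∀ i, Integrable (f i) (μ i)) (h0 : ∀ i x, 0 ≤ f i x) :
    Measure.pi (fun i => (μ i).withDensity fun x => ENNReal.ofReal (f i x))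
      = (Measure.pi μ).withDensity fun x => ENNReal.ofReal (∏ i, f i (x i)) := by
  have := fun i => isFiniteMeasure_withDensity_ofReal (hf i).2
  refine Measure.pi_eq fun s hs => ?_
  rw [withDensity_apply _ (MeasurableSet.univ_pi hs), Measure.restrict_pi_pi,
    ← ofReal_integral_eq_lintegral_ofReal (Integrable.fintype_prod_dep fun i =>
      (hf i).restrict) (Filter.Eventually.of_forall fun x => Finset.prod_nonneg fun i _ => h0 i _),
    integral_fintype_prod_eq_prod, ENNReal.ofReal_prod_of_nonneg
      fun i _ => integral_nonneg fun x => h0 i x]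
  refine Finset.prod_congr rfl fun i _ => ?_
  rw [withDensity_apply _ (hs i), ofReal_integral_eq_lintegral_ofReal (hf i).restrict
    (Filter.Eventually.of_forall fun x => h0 i x)]

/-- A density that factors through the map is carried along unchanged. This serves both the change
of variables for Z and the invariance under sign changes. -/
theorem map_withDensity_comp {α β : Type*} [MeasurableSpace α] [MeasurableSpace β]
    {μ : Measure α} {Φ : α → β} (hΦ : Measurable Φ) {h : β → ENNReal} (hh : Measurable h) :
    (μ.withDensity fun x => h (Φ x)).map Φ = (μ.map Φ).withDensity h := by
  ext s hs
  rw [Measure.map_apply hΦ hs, withDensity_apply _ (hΦ hs), withDensity_apply _ hs,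
    setLIntegral_map hs hh hΦ]

variable {n G : ℕ} {m : Fin G → ℕ}

/-- Concatenation of blocks of coordinates preserves Lebesgue measure. -/
theorem measurePreserving_concat (e : (Σ g, Fin (m g)) ≃ Fin n) :
    MeasurePreserving
      (fun (V : ∀ g, Fin (m g) → ℝ) (j : Fin n) => V (e.symm j).1 (e.symm j).2) := by
  have hmeas : Measurable
      (fun (V : ∀ g, Fin (m g) → ℝ) (j : Fin n) => V (e.symm j).1 (e.symm j).2) := by fun_prop
  refine ⟨hmeas, (Measure.pi_eq fun s hs => ?_).symm⟩
  have hpre : (fun (V : ∀ g, Fin (m g) → ℝ) (j : Fin n) => V (e.symm j).1 (e.symm j).2) ⁻¹'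
      (Set.univ.pi s) = Set.univ.pi fun g => Set.univ.pi fun i => s (e ⟨g, i⟩) := by
    ext V
    simp only [Set.mem_preimage, Set.mem_univ_pi]
    constructor
    · intro h g i
      have h' : V (e.symm (e ⟨g, i⟩)).1 (e.symm (e ⟨g, i⟩)).2 ∈ s (e ⟨g, i⟩) := h _
      rwa [e.symm_apply_apply] at h'
    · intro h j
      simpa using h (e.symm j).1 (e.symm j).2
  rw [Measure.map_apply hmeas (MeasurableSet.univ_pi hs), hpre, volume_pi_pi]
  simp_rw [volume_pi_pi]
  rw [← e.prod_comp, Fintype.prod_sigma]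

theorem tStdDensity_eq_exp {k : ℕ} {ν : ℝ} (hν : 2 < ν) (v : Fin k → ℝ) :
    tStdDensity k ν v
      = Real.exp (cConst ν k - (ν + k) / 2 * Real.log (1 + (v ⬝ᵥ v) / (ν - 2))) := by
  have h1 := Real.Gamma_pos_of_pos (show 0 < (ν + k) / 2 by positivity)
  have h2 := Real.Gamma_pos_of_pos (show 0 < ν / 2 by linarith)
  have h3 := dotProduct_self_nonneg' v
  have h4 : 0 < ν - 2 := sub_pos.mpr hν
  have h5 := Real.pi_pos
  have h6 : 0 < 1 + (v ⬝ᵥ v) / (ν - 2) := by positivity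
  rw [← Real.exp_log (tStdDensity_pos hν v), tStdDensity, Real.log_mul (by positivity)
    (by positivity), Real.log_mul (by positivity) (by positivity), Real.log_rpow (by positivity),
    Real.log_rpow h6, cConst]
  congr 1
  ring

/-- The two index types of P have equal cardinality, so a left inverse is a right inverse. -/
theorem mul_transpose_self_of_card {P : Matrix (Fin n) (Σ g, Fin (m g)) ℝ} (hm : n = ∑ g, m g)
    (hP : Pᵀ * P = 1) : P * Pᵀ = 1 :=
  (mul_eq_one_comm_of_card_eq _ _ _ (by simp [hm])).mp hP

theorem uOf_mulVec {P : Matrix (Fin n) (Σ g, Fin (m g)) ℝ}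
    {C : Matrix (Fin n) (Fin n) ℝ} (hC : C.PosDef) (w : (Σ g, Fin (m g)) → ℝ) :
    uOf C ((matSqrt C * P) *ᵥ w) = P *ᵥ w := by
  have hu := (Matrix.isUnit_iff_isUnit_det _).mp (posDef_matSqrt hC).isUnit
  rw [uOf, mulVec_mulVec, ← Matrix.mul_assoc, nonsing_inv_mul _ hu, Matrix.one_mul]

/-- The blocks of coordinates `V_g` of `Z = C^{1/2} P V`. -/
theorem vOf_mulVec {P : Matrix (Fin n) (Σ g, Fin (m g)) ℝ} (hP : Pᵀ * P = 1)
    {C : Matrix (Fin n) (Fin n) ℝ} (hC : C.PosDef) (w : (Σ g, Fin (m g)) → ℝ) (g : Fin G) :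
    vOf P C ((matSqrt C * P) *ᵥ w) g = fun i => w ⟨g, i⟩ := by
  rw [vOf, uOf_mulVec hC]
  ext i
  have : ((colBlock P g)ᵀ *ᵥ (P *ᵥ w)) i = (Pᵀ *ᵥ (P *ᵥ w)) ⟨g, i⟩ := rfl
  rw [this, mulVec_mulVec, hP, one_mulVec]

theorem continuous_vOf (P : Matrix (Fin n) (Σ g, Fin (m g)) ℝ) (C : Matrix (Fin n) (Fin n) ℝ)
    (g : Fin G) : Continuous fun z => vOf P C z g :=
  (continuous_const.matrix_mulVec (continuous_const.matrix_mulVec continuous_id))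

theorem measurable_logLik (m : Fin G → ℕ) (ν : Fin G → ℝ)
    (P : Matrix (Fin n) (Σ g, Fin (m g)) ℝ) (C : Matrix (Fin n) (Fin n) ℝ) :
    Measurable (logLik m ν P C) := by
  unfold logLik
  have h : ∀ g, Measurable fun z => vOf P C z g ⬝ᵥ vOf P C z g := fun g =>
    ((continuous_vOf P C g).dotProduct (continuous_vOf P C g)).measurable
  refine measurable_const.add (Finset.measurable_fun_sum _ fun g _ => ?_)
  exact measurable_const.sub (measurable_const.mul
    (Real.measurable_log.comp (measurable_const.add ((h g).div_const _))))

theorem ctStd_eq_withDensity (hm : n = ∑ g, m g) {ν : Fin G → ℝ} (hν : ∀ g, 2 < ν g)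
    {P : Matrix (Fin n) (Σ g, Fin (m g)) ℝ} (hP : Pᵀ * P = 1) {C : Matrix (Fin n) (Fin n) ℝ}
    (hC : C.PosDef) :
    ctStd m ν (matSqrt C * P) =
      volume.withDensity (fun z => ENNReal.ofReal (Real.exp (logLik m ν P C z))) := by
  have hS := posDef_matSqrt hC
  have hSd := hS.det_pos
  set e : (Σ g, Fin (m g)) ≃ Fin n := Fintype.equivOfCardEq (by simp [hm])
  -- The columns are reindexed by `Fin n` so that the determinant makes sense.
  set B : Matrix (Fin n) (Fin n) ℝ := (matSqrt C * P).submatrix id e.symm with hB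
  -- Orthonormality of P gives B B' = S S', so the absolute determinants agree whatever the
  -- reindexing and the sign of the determinant of P.
  have hBdet : |B.det| = (matSqrt C).det := by
    have h1 : B * Bᵀ = matSqrt C * (matSqrt C)ᵀ := by
      rw [hB, transpose_submatrix, submatrix_mul_equiv, transpose_mul, Matrix.mul_assoc,
        ← Matrix.mul_assoc P, mul_transpose_self_of_card hm hP, Matrix.one_mul, submatrix_id_id]
    have h2 := congrArg det h1
    rw [det_mul, det_mul, det_transpose, det_transpose] at h2
    rw [← abs_of_pos hSd]
    exact (abs_eq_abs.mpr (mul_self_eq_mul_self_iff.mp h2))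
  have hB0 : B.det ≠ 0 := by
    rw [← abs_pos, hBdet]
    exact hSd
  have hlog : Real.log C.det = 2 * Real.log (matSqrt C).det := by
    conv_lhs => rw [← matSqrt_mul_self hC, det_mul]
    rw [Real.log_mul hSd.ne' hSd.ne', two_mul]
  have hint : ∀ g, Integrable (tStdDensity (m g) (ν g)) := fun g => by
    have := isProbabilityMeasure_tStd (k := m g) (hν g)
    simpa using (integrable_tStd_iff (hν g)).mp (integrable_const (1 : ℝ))
  have hpi : Measure.pi (fun g => tStd (m g) (ν g)) = volume.withDensity
      fun V : ∀ g, Fin (m g) → ℝ => ENNReal.ofReal (∏ g, tStdDensity (m g) (ν g) (V g)) :=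
    pi_withDensity_ofReal _ hint fun g v => (tStdDensity_pos (hν g) v).le
  set Φ : (∀ g, Fin (m g) → ℝ) → Fin n → ℝ :=
    fun V => (matSqrt C * P) *ᵥ fun s : Σ g, Fin (m g) => V s.1 s.2 with hΦ
  have hΦe : Φ = (toLin' B) ∘
      (fun (V : ∀ g, Fin (m g) → ℝ) (j : Fin n) => V (e.symm j).1 (e.symm j).2) := by
    ext V i
    simp only [hΦ, Function.comp_apply, toLin'_apply, hB, mulVec, dotProduct, submatrix_apply, id]
    exact (Equiv.sum_comp e.symm (fun s => (matSqrt C * P) i s * V s.1 s.2)).symm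
  have hlin : Measurable (toLin' B) := (toLin' B).continuous_of_finiteDimensional.measurable
  have hcat := measurePreserving_concat e
  have hΦm : Measurable Φ := hΦe ▸ hlin.comp hcat.measurable
  have hvol : (volume : Measure (∀ g, Fin (m g) → ℝ)).map Φ
      = ENNReal.ofReal (matSqrt C).det⁻¹ • volume := by
    rw [hΦe, ← Measure.map_map hlin hcat.measurable, hcat.map_eq,
      Real.map_matrix_volume_pi_eq_smul_volume_pi hB0, abs_inv, hBdet]
  -- The density of V as a function of Z carries the extra factor |C|^{1/2}, which the Jacobian of
  -- the linear map then removes.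
  have hdens : ∀ V : ∀ g, Fin (m g) → ℝ, ENNReal.ofReal (∏ g, tStdDensity (m g) (ν g) (V g))
      = (fun z => ENNReal.ofReal ((matSqrt C).det * Real.exp (logLik m ν P C z))) (Φ V) := by
    intro V
    simp only [hΦ, logLik, vOf_mulVec hP hC, hlog]
    congr 1
    rw [Finset.prod_congr rfl fun g _ => tStdDensity_eq_exp (hν g) (V g), ← Real.exp_sum,
      Real.exp_add]
    have : -(1 / 2) * (2 * Real.log (matSqrt C).det) = -Real.log (matSqrt C).det := by ring
    rw [this, Real.exp_neg, Real.exp_log hSd, ← mul_assoc, mul_inv_cancel₀ hSd.ne', one_mul]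
  have hmeas := measurable_logLik m ν P C
  have hct : ctStd m ν (matSqrt C * P) = (Measure.pi fun g => tStd (m g) (ν g)).map Φ := rfl
  have hmap := map_withDensity_comp (μ := volume) hΦm
    (h := fun z => ENNReal.ofReal ((matSqrt C).det * Real.exp (logLik m ν P C z))) (by fun_prop)
  rw [hct, hpi, funext hdens]
  refine hmap.trans ?_
  rw [hvol, withDensity_smul_measure,
    ← withDensity_smul _ (by fun_prop)]
  congr 1
  ext z
  rw [Pi.smul_apply, smul_eq_mul, ← ENNReal.ofReal_mul (by positivity), ← mul_assoc,
    inv_mul_cancel₀ hSd.ne', one_mul]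

end Density

/-! ### Second and fourth moments of the independent blocks -/

section Moments

variable {G : ℕ} {m : Fin G → ℕ} {ν : Fin G → ℝ}

/-- The law of the independent blocks `(V_1, …, V_G)`. -/
abbrev blockLaw (m : Fin G → ℕ) (ν : Fin G → ℝ) : Measure (∀ g, Fin (m g) → ℝ) :=
  Measure.pi fun g => tStd (m g) (ν g)

/-- The entry `W_g V_a V_b` of `W_g V_g V_h'`, where `a` is in block `g` and `b` in block `h`. -/
def weightedEntry (ν : Fin G → ℝ) (a b : Σ g, Fin (m g)) (V : ∀ g, Fin (m g) → ℝ) : ℝ :=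
  tWeight (ν a.1) (V a.1) * V a.1 a.2 * V b.1 b.2

theorem measurable_tWeight {k : ℕ} (ν : ℝ) : Measurable (tWeight ν : (Fin k → ℝ) → ℝ) := by
  unfold tWeight
  simp only [dotProduct]
  fun_prop

theorem measurable_weightedEntry (ν : Fin G → ℝ) (a b : Σ g, Fin (m g)) :
    Measurable (weightedEntry ν a b) := by
  have h : ∀ g, Measurable fun V : ∀ g, Fin (m g) → ℝ => V g := fun g => measurable_pi_apply g
  exact (((measurable_tWeight _).comp (h a.1)).mul ((measurable_pi_apply a.2).comp (h a.1))).mul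
    ((measurable_pi_apply b.2).comp (h b.1))

/-- Lebesgue measure is invariant under sign changes, and the density depends on v'v only. -/
theorem measurePreserving_signs_tStd {k : ℕ} (ν : ℝ) {ε : Fin k → ℝ}
    (hε : ∀ i, ε i = 1 ∨ ε i = -1) :
    MeasurePreserving (fun (v : Fin k → ℝ) i => ε i * v i) (tStd k ν) (tStd k ν) := by
  have hvol : MeasurePreserving (fun (v : Fin k → ℝ) i => ε i * v i) := by
    refine volume_preserving_pi fun i => ?_
    rcases hε i with h | h
    · have : HMul.hMul (ε i) = id := by ext x; simp [h]
      rw [this]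
      exact MeasurePreserving.id volume
    · have : HMul.hMul (ε i) = Neg.neg := by ext x; simp [h]
      rw [this]
      exact Measure.measurePreserving_neg volume
  refine ⟨hvol.measurable, ?_⟩
  have hd : ∀ v : Fin k → ℝ, tStdDensity k ν (fun i => ε i * v i) = tStdDensity k ν v := by
    intro v
    have : (fun i => ε i * v i) ⬝ᵥ (fun i => ε i * v i) = v ⬝ᵥ v := by
      refine Finset.sum_congr rfl fun i _ => ?_
      rcases hε i with h | h <;> simp [h]
    rw [tStdDensity, tStdDensity, this]
  have h1 := map_withDensity_comp (μ := volume) hvol.measurable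
    (measurable_tStdDensity k ν).ennreal_ofReal
  simp only [hd] at h1
  rw [tStd, h1, hvol.map_eq]

theorem isProbabilityMeasure_blockLaw (hν : ∀ g, 2 < ν g) : IsProbabilityMeasure (blockLaw m ν) := by
  have := fun g => isProbabilityMeasure_tStd (k := m g) (hν g)
  infer_instance

/-- The law of the blocks is invariant under changes of the signs of the coordinates. -/
theorem integral_comp_signs (hν : ∀ g, 2 < ν g) {ε : (Σ g, Fin (m g)) → ℝ} (hε : ∀ s, ε s = 1 ∨ ε s = -1)
    {f : (∀ g, Fin (m g) → ℝ) → ℝ} (hf : Measurable f) :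
    ∫ V, f (fun g i => ε ⟨g, i⟩ * V g i) ∂(blockLaw m ν) = ∫ V, f V ∂(blockLaw m ν) := by
  have := fun g => isProbabilityMeasure_tStd (k := m g) (hν g)
  have h := measurePreserving_pi (fun g => tStd (m g) (ν g)) (fun g => tStd (m g) (ν g))
    (f := fun g v i => ε ⟨g, i⟩ * v i)
    (fun g => measurePreserving_signs_tStd (ν g) fun i => hε ⟨g, i⟩)
  conv_rhs => rw [blockLaw, ← h.map_eq]
  rw [integral_map h.measurable.aemeasurable hf.aestronglyMeasurable]

theorem weightedEntry_signs {ε : (Σ g, Fin (m g)) → ℝ} (hε : ∀ s, ε s = 1 ∨ ε s = -1)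
    (a b : Σ g, Fin (m g)) (V : ∀ g, Fin (m g) → ℝ) :
    weightedEntry ν a b (fun g i => ε ⟨g, i⟩ * V g i) = ε a * ε b * weightedEntry ν a b V := by
  have : (fun i => ε ⟨a.1, i⟩ * V a.1 i) ⬝ᵥ (fun i => ε ⟨a.1, i⟩ * V a.1 i)
      = V a.1 ⬝ᵥ V a.1 := by
    refine Finset.sum_congr rfl fun i _ => ?_
    rcases hε ⟨a.1, i⟩ with h | h <;> simp [h]
  rw [weightedEntry, weightedEntry, tWeight, tWeight, this]
  ring

theorem integral_weightedEntry_of_ne (hν : ∀ g, 2 < ν g) {a b : Σ g, Fin (m g)} (hab : a ≠ b) :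
    ∫ V, weightedEntry ν a b V ∂(blockLaw m ν) = 0 := by
  -- Flipping the coordinate `a` alone reverses the sign of the integrand, so the integral equals
  -- its own negative.
  set ε : (Σ g, Fin (m g)) → ℝ := fun s => if s = a then -1 else 1 with hεd
  have hε : ∀ s, ε s = 1 ∨ ε s = -1 := fun s => by
    by_cases h : s = a <;> simp [hεd, h]
  have h := integral_comp_signs hν hε (measurable_weightedEntry ν a b)
  simp only [weightedEntry_signs hε] at h
  rw [integral_const_mul] at h
  have h1 : ε a = -1 := if_pos rfl
  have h2 : ε b = 1 := if_neg hab.symm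
  rw [h1, h2] at h
  linarith

/-- The fourth moments vanish if some coordinate has an odd exponent. -/
theorem integral_weightedEntry_mul_eq_zero (hν : ∀ g, 2 < ν g) (s : Σ g, Fin (m g)) {a b c d : Σ g, Fin (m g)}
    (hs : (if a = s then (-1 : ℝ) else 1) * (if b = s then -1 else 1)
      * ((if c = s then -1 else 1) * (if d = s then -1 else 1)) = -1) :
    ∫ V, weightedEntry ν a b V * weightedEntry ν c d V ∂(blockLaw m ν) = 0 := by
  set ε : (Σ g, Fin (m g)) → ℝ := fun t => if t = s then -1 else 1 with hεd
  have hε : ∀ t, ε t = 1 ∨ ε t = -1 := fun t => by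
    by_cases h : t = s <;> simp [hεd, h]
  have h := integral_comp_signs hν hε
    ((measurable_weightedEntry ν a b).mul (measurable_weightedEntry ν c d))
  have h1 : ∀ V, (weightedEntry ν a b * weightedEntry ν c d) (fun g i => ε ⟨g, i⟩ * V g i)
      = (-1) * (weightedEntry ν a b V * weightedEntry ν c d V) := fun V => by
    rw [Pi.mul_apply, weightedEntry_signs hε, weightedEntry_signs hε, ← hs]
    ring
  simp only [h1, Pi.mul_apply] at h
  rw [integral_const_mul] at h
  linarith

theorem integral_block (hν : ∀ g, 2 < ν g) (g : Fin G) {F : (Fin (m g) → ℝ) → ℝ}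
    (hF : Measurable F) : ∫ V, F (V g) ∂(blockLaw m ν) = ∫ v, F v ∂(tStd (m g) (ν g)) := by
  have := fun g => isProbabilityMeasure_tStd (k := m g) (hν g)
  exact integral_comp_eval hF.aestronglyMeasurable

theorem integral_block_mul_block (hν : ∀ g, 2 < ν g) {g h : Fin G} (hgh : g ≠ h) {F : (Fin (m g) → ℝ) → ℝ}
    {H : (Fin (m h) → ℝ) → ℝ} (hF : Measurable F) (hH : Measurable H) :
    ∫ V, F (V g) * H (V h) ∂(blockLaw m ν)
      = (∫ v, F v ∂(tStd (m g) (ν g))) * ∫ v, H v ∂(tStd (m h) (ν h)) := by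
  have := fun g => isProbabilityMeasure_tStd (k := m g) (hν g)
  have hind := (iIndepFun_pi (μ := fun g => tStd (m g) (ν g)) (X := fun g v => v)
    fun g => aemeasurable_id).indepFun hgh
  rw [hind.integral_fun_comp_mul_comp (measurable_pi_apply _).aemeasurable
    (measurable_pi_apply _).aemeasurable hF.aestronglyMeasurable
    hH.aestronglyMeasurable, integral_comp_eval hF.aestronglyMeasurable,
    integral_comp_eval hH.aestronglyMeasurable]

theorem integral_weightedEntry_self (hν : ∀ g, 2 < ν g) (a : Σ g, Fin (m g)) :
    ∫ V, weightedEntry ν a a V ∂(blockLaw m ν) = 1 := by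
  rw [← integral_weight_mul_sq_tStd (hν a.1) a.2,
    ← integral_block hν a.1 (F := fun v => tWeight (ν a.1) v * v a.2 ^ 2)
      ((measurable_tWeight _).mul (by fun_prop))]
  refine integral_congr_ae (Filter.Eventually.of_forall fun V => ?_)
  simp only [weightedEntry]
  ring

theorem integral_weightedEntry (hν : ∀ g, 2 < ν g) (a b : Σ g, Fin (m g)) :
    ∫ V, weightedEntry ν a b V ∂(blockLaw m ν) = if a = b then 1 else 0 := by
  split_ifs with h
  · rw [h, integral_weightedEntry_self hν]
  · exact integral_weightedEntry_of_ne hν h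

theorem integral_weightedEntry_four (hν : ∀ g, 2 < ν g) (a : Σ g, Fin (m g)) :
    ∫ V, weightedEntry ν a a V * weightedEntry ν a a V ∂(blockLaw m ν)
      = 3 * phiConst (ν a.1) (m a.1) := by
  rw [← integral_weight_sq_mul_pow_four_tStd (hν a.1) a.2,
    ← integral_block hν a.1 (F := fun v => tWeight (ν a.1) v ^ 2 * v a.2 ^ 4)
      (((measurable_tWeight _).pow_const 2).mul (by fun_prop))]
  refine integral_congr_ae (Filter.Eventually.of_forall fun V => ?_)
  simp only [weightedEntry]
  ring

/-- In one block both entries share the weight, which gives the mixed fourth moment; across blocks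
independence leaves a product of two unit means. -/
theorem integral_weightedEntry_diag (hν : ∀ g, 2 < ν g) {a c : Σ g, Fin (m g)} (hac : a ≠ c) :
    ∫ V, weightedEntry ν a a V * weightedEntry ν c c V ∂(blockLaw m ν)
      = if a.1 = c.1 then phiConst (ν a.1) (m a.1) else 1 := by
  obtain ⟨g, i⟩ := a
  obtain ⟨h, j⟩ := c
  split_ifs with hgh
  · obtain rfl : g = h := hgh
    have hij : i ≠ j := fun hij => hac (by rw [hij])
    rw [← integral_weight_sq_mul_sq_mul_sq_tStd (hν g) hij,
      ← integral_block hν g (F := fun v => tWeight (ν g) v ^ 2 * (v i ^ 2 * v j ^ 2))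
        (((measurable_tWeight _).pow_const 2).mul (by fun_prop))]
    refine integral_congr_ae (Filter.Eventually.of_forall fun V => ?_)
    simp only [weightedEntry]
    ring
  · have hgh : g ≠ h := hgh
    have := integral_block_mul_block hν hgh
      (F := fun v => tWeight (ν g) v * v i ^ 2) (H := fun v => tWeight (ν h) v * v j ^ 2)
      ((measurable_tWeight _).mul (by fun_prop)) ((measurable_tWeight _).mul (by fun_prop))
    rw [integral_weight_mul_sq_tStd (hν g), integral_weight_mul_sq_tStd (hν h), mul_one] at this
    rw [← this]
    refine integral_congr_ae (Filter.Eventually.of_forall fun V => ?_)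
    simp only [weightedEntry]
    ring

/-- Both weights come from the block of `a`. Across blocks the coordinate `b` is independent of them
and has unit variance, so ψ replaces φ. -/
theorem integral_weightedEntry_sq (hν : ∀ g, 2 < ν g) {a b : Σ g, Fin (m g)} (hab : a ≠ b) :
    ∫ V, weightedEntry ν a b V * weightedEntry ν a b V ∂(blockLaw m ν)
      = if a.1 = b.1 then phiConst (ν a.1) (m a.1) else psiConst (ν a.1) (m a.1) := by
  obtain ⟨g, i⟩ := a
  obtain ⟨h, j⟩ := b
  split_ifs with hgh
  · obtain rfl : g = h := hgh
    have hij : i ≠ j := fun hij => hab (by rw [hij])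
    rw [← integral_weight_sq_mul_sq_mul_sq_tStd (hν g) hij,
      ← integral_block hν g (F := fun v => tWeight (ν g) v ^ 2 * (v i ^ 2 * v j ^ 2))
        (((measurable_tWeight _).pow_const 2).mul (by fun_prop))]
    refine integral_congr_ae (Filter.Eventually.of_forall fun V => ?_)
    simp only [weightedEntry]
    ring
  · have hgh : g ≠ h := hgh
    have := integral_block_mul_block hν hgh
      (F := fun v => tWeight (ν g) v ^ 2 * v i ^ 2) (H := fun v => v j ^ 2)
      (((measurable_tWeight _).pow_const 2).mul (by fun_prop)) (by fun_prop)
    rw [integral_weight_sq_mul_sq_tStd (hν g), integral_sq_tStd (hν h), mul_one] at this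
    rw [← this]
    refine integral_congr_ae (Filter.Eventually.of_forall fun V => ?_)
    simp only [weightedEntry]
    ring

/-- The fourth-order moments of the blocks. -/
theorem integral_weightedEntry_mul (hν : ∀ g, 2 < ν g) (a b c d : Σ g, Fin (m g)) :
    ∫ V, weightedEntry ν a b V * weightedEntry ν c d V ∂(blockLaw m ν)
      = (if a = b ∧ c = d then (if a.1 = c.1 then phiConst (ν a.1) (m a.1) else 1) else 0)
        + (if a = c ∧ b = d then
            (if a.1 = b.1 then phiConst (ν a.1) (m a.1) else psiConst (ν a.1) (m a.1)) else 0)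
        + (if a = d ∧ b = c then (if a.1 = b.1 then phiConst (ν a.1) (m a.1) else 1) else 0) := by
  -- Unless the four indices pair up, some index occurs an odd number of times and its sign change
  -- kills the integral. When all four coincide the three pairings overlap and add up to 3φ.
  by_cases hab : a = b
  · subst hab
    by_cases hcd : c = d
    · subst hcd
      by_cases hac : a = c
      · subst hac
        rw [integral_weightedEntry_four hν]
        simp
        ring
      · rw [integral_weightedEntry_diag hν hac]
        simp [hac]
    · rw [integral_weightedEntry_mul_eq_zero hν c (by
        rcases eq_or_ne a c with h | h <;> simp [h, Ne.symm hcd])]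
      have h1 : ¬(a = c ∧ a = d) := fun h => hcd (h.1.symm.trans h.2)
      have h2 : ¬(a = d ∧ a = c) := fun h => hcd (h.2.symm.trans h.1)
      simp [hcd, h1, h2]
  · by_cases hac : a = c
    · subst hac
      by_cases hbd : b = d
      · subst hbd
        rw [integral_weightedEntry_sq hν hab]
        simp [hab, Ne.symm hab]
      · rw [integral_weightedEntry_mul_eq_zero hν b (by simp [hab, Ne.symm hbd])]
        simp [hab, hbd, Ne.symm hab]
    · by_cases had : a = d
      · subst had
        by_cases hbc : b = c
        · subst hbc
          have h : ∀ V : ∀ g, Fin (m g) → ℝ, weightedEntry ν a b V * weightedEntry ν b a V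
              = weightedEntry ν a a V * weightedEntry ν b b V := fun V => by
            simp only [weightedEntry]
            ring
          simp_rw [h]
          rw [integral_weightedEntry_diag hν hab]
          simp [hab]
        · rw [integral_weightedEntry_mul_eq_zero hν b (by simp [hab, Ne.symm hbc])]
          simp [hab, hac, hbc]
      · rw [integral_weightedEntry_mul_eq_zero hν a (by
          simp [Ne.symm hab, Ne.symm hac, Ne.symm had])]
        simp [hab, hac, had]

/-- The weight decays like 1/v'v and |v_i| ≤ 1 + v_i², so the product is bounded. -/
theorem abs_tWeight_mul_le {k : ℕ} {ν : ℝ} (hν : 2 < ν) (v : Fin k → ℝ) (i : Fin k) :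
    |tWeight ν v * v i| ≤ (ν + k) * (1 + 1 / (ν - 2)) := by
  have h0 : 0 < ν - 2 := sub_pos.mpr hν
  have h1 : v i ^ 2 ≤ v ⬝ᵥ v := by
    rw [sq]
    exact Finset.single_le_sum (f := fun i => v i * v i) (fun j _ => mul_self_nonneg _)
      (Finset.mem_univ i)
  have h2 := dotProduct_self_nonneg' v
  have h3 : 0 < ν - 2 + v ⬝ᵥ v := by positivity
  have h4 : 0 < ν + k := by positivity
  rw [abs_mul, tWeight, abs_of_pos (div_pos h4 h3), div_mul_eq_mul_div, div_le_iff₀ h3, mul_assoc]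
  refine mul_le_mul_of_nonneg_left ?_ h4.le
  have h5 : |v i| ≤ 1 + v i ^ 2 := by
    rw [← sq_abs]
    nlinarith [sq_nonneg (|v i| - 1), abs_nonneg (v i)]
  have h6 : (1 + 1 / (ν - 2)) * (ν - 2 + v ⬝ᵥ v)
      = 1 + v ⬝ᵥ v + ((ν - 2) + (v ⬝ᵥ v) / (ν - 2)) := by
    field_simp
    ring
  rw [h6]
  have : 0 ≤ (ν - 2) + (v ⬝ᵥ v) / (ν - 2) := by positivity
  linarith

theorem memLp_coord (hν : ∀ g, 2 < ν g) (b : Σ g, Fin (m g)) :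
    MemLp (fun V : ∀ g, Fin (m g) → ℝ => V b.1 b.2) 2 (blockLaw m ν) := by
  have := fun g => isProbabilityMeasure_tStd (k := m g) (hν g)
  have h : Measurable fun V : ∀ g, Fin (m g) → ℝ => V b.1 := measurable_pi_apply b.1
  have h' : Measurable fun V : ∀ g, Fin (m g) → ℝ => V b.1 b.2 := (measurable_pi_apply b.2).comp h
  rw [memLp_two_iff_integrable_sq h'.aestronglyMeasurable]
  exact integrable_comp_eval (μ := fun g => tStd (m g) (ν g)) (integrable_sq_tStd (hν b.1) b.2)

/-- Bounding each W V reduces the claim to a product of two square-integrable coordinates, so ν > 2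
suffices and unweighted fourth moments are not used. -/
theorem integrable_weightedEntry_mul (hν : ∀ g, 2 < ν g) (a b c d : Σ g, Fin (m g)) :
    Integrable (fun V => weightedEntry ν a b V * weightedEntry ν c d V) (blockLaw m ν) := by
  have hm : ∀ s : Σ g, Fin (m g), Measurable fun V : ∀ g, Fin (m g) → ℝ =>
      tWeight (ν s.1) (V s.1) * V s.1 s.2 := fun s =>
    have h : Measurable fun V : ∀ g, Fin (m g) → ℝ => V s.1 := measurable_pi_apply s.1
    ((measurable_tWeight _).comp h).mul ((measurable_pi_apply s.2).comp h)
  have h := ((memLp_coord hν b).integrable_mul (memLp_coord hν d)).bdd_mul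
    (f := fun V : ∀ g, Fin (m g) → ℝ => (tWeight (ν a.1) (V a.1) * V a.1 a.2)
      * (tWeight (ν c.1) (V c.1) * V c.1 c.2))
    (c := ((ν a.1 + m a.1) * (1 + 1 / (ν a.1 - 2))) * ((ν c.1 + m c.1) * (1 + 1 / (ν c.1 - 2))))
    ((hm a).mul (hm c)).aestronglyMeasurable (Filter.Eventually.of_forall fun V => by
      rw [Real.norm_eq_abs, abs_mul]
      exact mul_le_mul (abs_tWeight_mul_le (hν _) _ _) (abs_tWeight_mul_le (hν _) _ _)
        (abs_nonneg _) ((abs_nonneg _).trans (abs_tWeight_mul_le (hν _) (V a.1) a.2)))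
  refine h.congr (Filter.Eventually.of_forall fun V => ?_)
  simp only [weightedEntry, Pi.mul_apply]
  ring

theorem integrable_weightedEntry (hν : ∀ g, 2 < ν g) (a b : Σ g, Fin (m g)) :
    Integrable (weightedEntry ν a b) (blockLaw m ν) := by
  have := isProbabilityMeasure_blockLaw (m := m) hν
  refine MemLp.integrable (q := 2) (by norm_num) ?_
  rw [memLp_two_iff_integrable_sq (measurable_weightedEntry ν a b).aestronglyMeasurable]
  simp only [sq]
  exact integrable_weightedEntry_mul hν a b a b

end Moments

/-! ### The covariance matrix of the blocks and its conjugate by P ⊗ P -/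

section Covariance

variable {n G : ℕ} {m : Fin G → ℕ}

/-- The indicator of the block `g`, as a diagonal matrix. -/
def blockInd (m : Fin G → ℕ) (g : Fin G) : Matrix (Σ g, Fin (m g)) (Σ g, Fin (m g)) ℝ :=
  diagonal fun s => if s.1 = g then 1 else 0

/-- The commutation matrix for the index set of the blocks. -/
def blockComm (m : Fin G → ℕ) : Matrix ((Σ g, Fin (m g)) × Σ g, Fin (m g))
    ((Σ g, Fin (m g)) × Σ g, Fin (m g)) ℝ :=
  Matrix.of fun p q => if q = p.swap then 1 else 0

/-- The entry of `W_g V_g V_h' - δ_{gh} I`. -/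
def centeredEntry (ν : Fin G → ℝ) (p : (Σ g, Fin (m g)) × Σ g, Fin (m g))
    (V : ∀ g, Fin (m g) → ℝ) : ℝ :=
  weightedEntry ν p.2 p.1 V - if p.2 = p.1 then 1 else 0

/-- The covariance matrix of the entries `W_g V_g V_h'`. -/
def blockCov (m : Fin G → ℕ) (ν : Fin G → ℝ) : Matrix ((Σ g, Fin (m g)) × Σ g, Fin (m g))
    ((Σ g, Fin (m g)) × Σ g, Fin (m g)) ℝ :=
  blockComm m + ∑ g, (psiConst (ν g) (m g) • ((1 : Matrix _ _ ℝ) ⊗ₖ blockInd m g)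
    + (phiConst (ν g) (m g) - psiConst (ν g) (m g)) • (blockInd m g ⊗ₖ blockInd m g)
    + (phiConst (ν g) (m g) - 1) • ((blockInd m g ⊗ₖ blockInd m g) * blockComm m
        + vecMulVec (vec (blockInd m g)) (vec (blockInd m g))))

theorem integrable_centeredEntry_mul {ν : Fin G → ℝ} (hν : ∀ g, 2 < ν g)
    (p q : (Σ g, Fin (m g)) × Σ g, Fin (m g)) :
    Integrable (fun V => centeredEntry ν p V * centeredEntry ν q V) (blockLaw m ν) := by
  have := isProbabilityMeasure_blockLaw (m := m) hν
  simp only [centeredEntry, sub_mul, mul_sub]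
  exact ((integrable_weightedEntry_mul hν _ _ _ _).sub
    ((integrable_weightedEntry hν _ _).const_mul _)).sub
    (((integrable_weightedEntry hν _ _).mul_const _).sub (integrable_const _))

theorem mul_blockComm_apply {α : Type*} (A : Matrix α ((Σ g, Fin (m g)) × Σ g, Fin (m g)) ℝ)
    (p : α) (q : (Σ g, Fin (m g)) × Σ g, Fin (m g)) : (A * blockComm m) p q = A p q.swap := by
  have : ∀ x : (Σ g, Fin (m g)) × Σ g, Fin (m g), q = x.swap ↔ q.swap = x := fun x =>
    ⟨fun h => by rw [h, Prod.swap_swap], fun h => by rw [← h, Prod.swap_swap]⟩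
  simp [mul_apply, blockComm, this]

theorem blockComm_mul_apply {α : Type*} (A : Matrix ((Σ g, Fin (m g)) × Σ g, Fin (m g)) α ℝ)
    (p : (Σ g, Fin (m g)) × Σ g, Fin (m g)) (q : α) : (blockComm m * A) p q = A p.swap q := by
  simp [mul_apply, blockComm]

theorem mul_commMat_apply {α : Type*} (A : Matrix α (Fin n × Fin n) ℝ)
    (p : α) (q : Fin n × Fin n) : (A * commMat n) p q = A p q.swap := by
  have : ∀ x : Fin n × Fin n, q = x.swap ↔ q.swap = x := fun x =>
    ⟨fun h => by rw [h, Prod.swap_swap], fun h => by rw [← h, Prod.swap_swap]⟩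
  simp [mul_apply, commMat, this]

theorem blockCov_apply (ν : Fin G → ℝ) (p q : (Σ g, Fin (m g)) × Σ g, Fin (m g)) :
    blockCov m ν p q = (if q = p.swap then 1 else 0)
      + ((if p = q then psiConst (ν p.2.1) (m p.2.1) else 0)
      + (if p = q ∧ p.1.1 = p.2.1 then phiConst (ν p.2.1) (m p.2.1) - psiConst (ν p.2.1) (m p.2.1)
          else 0)
      + ((if q = p.swap ∧ p.1.1 = p.2.1 then phiConst (ν p.2.1) (m p.2.1) - 1 else 0)
      + (if p.2 = p.1 ∧ q.2 = q.1 ∧ p.2.1 = q.2.1 then phiConst (ν p.2.1) (m p.2.1) - 1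
          else 0))) := by
  -- Every term of the sum over blocks carries the indicator of the block of `p.2`, so a single
  -- block contributes.
  rw [blockCov, Matrix.add_apply, Matrix.sum_apply,
    Finset.sum_eq_single p.2.1 (fun g _ hg => ?_) (by simp)]
  · congr 1
    simp only [Matrix.add_apply, Matrix.smul_apply, mul_blockComm_apply, kroneckerMap_apply,
      vecMulVec_apply, vec, blockInd, diagonal_apply, one_apply, smul_eq_mul, mul_add]
    obtain ⟨a, b⟩ := p
    obtain ⟨c, d⟩ := q
    simp only [Prod.mk.injEq, Prod.swap]
    congr 1
    · congr 1
      · grind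
      · grind
    · congr 1
      · grind
      · grind
  · simp only [Matrix.add_apply, Matrix.smul_apply, mul_blockComm_apply, kroneckerMap_apply,
      vecMulVec_apply, vec, blockInd, diagonal_apply, smul_eq_mul, if_neg hg.symm, ite_self,
      mul_zero, zero_mul, add_zero]

theorem integral_centeredEntry_mul {ν : Fin G → ℝ} (hν : ∀ g, 2 < ν g)
    (p q : (Σ g, Fin (m g)) × Σ g, Fin (m g)) :
    ∫ V, centeredEntry ν p V * centeredEntry ν q V ∂(blockLaw m ν) = blockCov m ν p q := by
  have := isProbabilityMeasure_blockLaw (m := m) hν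
  have h : ∫ V, centeredEntry ν p V * centeredEntry ν q V ∂(blockLaw m ν)
      = ∫ V, weightedEntry ν p.2 p.1 V * weightedEntry ν q.2 q.1 V ∂(blockLaw m ν)
        - (if p.2 = p.1 then 1 else 0) * if q.2 = q.1 then 1 else 0 := by
    simp only [centeredEntry, sub_mul, mul_sub]
    rw [integral_sub, integral_sub, integral_sub, integral_const_mul, integral_mul_const,
      integral_const, integral_weightedEntry hν, integral_weightedEntry hν]
    · simp
    · exact (integrable_weightedEntry hν _ _).mul_const _
    · exact integrable_const _
    · exact integrable_weightedEntry_mul hν _ _ _ _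
    · exact (integrable_weightedEntry hν _ _).const_mul _
    · exact (integrable_weightedEntry_mul hν _ _ _ _).sub
        ((integrable_weightedEntry hν _ _).const_mul _)
    · exact ((integrable_weightedEntry hν _ _).mul_const _).sub (integrable_const _)
  rw [h, integral_weightedEntry_mul hν, blockCov_apply]
  obtain ⟨a, b⟩ := p
  obtain ⟨c, d⟩ := q
  simp only [Prod.mk.injEq, Prod.swap]
  -- The three pairings match the terms of the covariance. The first, less the product of the means,
  -- gives the rank-one term. The second gives the terms in ψ and φ - ψ. The third gives the
  -- commutation matrix and its correction inside a block.
  have e1 : (if b = a ∧ d = c then (if b.1 = d.1 then phiConst (ν b.1) (m b.1) else 1) else 0)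
      - (if b = a then (1 : ℝ) else 0) * (if d = c then 1 else 0)
      = if b = a ∧ d = c ∧ b.1 = d.1 then phiConst (ν b.1) (m b.1) - 1 else 0 := by
    grind
  have e2 : (if b = d ∧ a = c then
        (if b.1 = a.1 then phiConst (ν b.1) (m b.1) else psiConst (ν b.1) (m b.1)) else 0)
      = (if a = c ∧ b = d then psiConst (ν b.1) (m b.1) else 0)
        + if (a = c ∧ b = d) ∧ a.1 = b.1 then
            phiConst (ν b.1) (m b.1) - psiConst (ν b.1) (m b.1) else 0 := by
    grind
  have e3 : (if b = c ∧ a = d then (if b.1 = a.1 then phiConst (ν b.1) (m b.1) else 1) else 0)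
      = (if c = b ∧ d = a then (1 : ℝ) else 0)
        + if (c = b ∧ d = a) ∧ a.1 = b.1 then phiConst (ν b.1) (m b.1) - 1 else 0 := by
    grind
  linarith

theorem jMat_eq (P : Matrix (Fin n) (Σ g, Fin (m g)) ℝ) (g : Fin G) :
    jMat P g = P * blockInd m g * Pᵀ := by
  ext i j
  rw [mul_apply, Fintype.sum_sigma, Finset.sum_eq_single g]
  · simp only [blockInd, mul_diagonal]
    simp [jMat, colBlock, mul_apply]
  · intro h _ hh
    simp [blockInd, hh]
  · simp

/-- Conjugation preserves the identity since P P' = I and sends the indicator of block g to J_g. The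
commutation matrices pass through because both Kronecker factors are the same P. -/
theorem kronecker_mul_blockCov_mul (ν : Fin G → ℝ) {P : Matrix (Fin n) (Σ g, Fin (m g)) ℝ}
    (hP : P * Pᵀ = 1) :
    (P ⊗ₖ P) * blockCov m ν * (P ⊗ₖ P)ᵀ = commMat n + upsilonMat ν P := by
  have hK : blockComm m * (P ⊗ₖ P)ᵀ = (P ⊗ₖ P)ᵀ * commMat n := by
    ext p q
    rw [blockComm_mul_apply, mul_commMat_apply]
    simp [mul_comm]
  have hT : (P ⊗ₖ P)ᵀ = Pᵀ ⊗ₖ Pᵀ := kroneckerMap_transpose _ _ _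
  have h1 : (P ⊗ₖ P) * (P ⊗ₖ P)ᵀ = 1 := by
    rw [hT, ← mul_kronecker_mul, hP, one_kronecker_one]
  have hv : ∀ g, (P ⊗ₖ P) *ᵥ vec (blockInd m g) = vec (jMat P g) := fun g => by
    rw [kronecker_mulVec_vec, jMat_eq]
  rw [blockCov, Matrix.mul_add, Matrix.add_mul, Matrix.mul_sum, Matrix.sum_mul, upsilonMat]
  congr 1
  · rw [Matrix.mul_assoc, hK, ← Matrix.mul_assoc, h1, Matrix.one_mul]
  · refine Finset.sum_congr rfl fun g _ => ?_
    have hDD : (P ⊗ₖ P) * (blockInd m g ⊗ₖ blockInd m g) * (P ⊗ₖ P)ᵀ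
        = jMat P g ⊗ₖ jMat P g := by
      rw [hT, ← mul_kronecker_mul, ← mul_kronecker_mul, jMat_eq]
    simp only [psiMat, Matrix.mul_add, Matrix.add_mul, Matrix.mul_smul, Matrix.smul_mul]
    congr 1
    · congr 1
      · rw [hT, ← mul_kronecker_mul, ← mul_kronecker_mul, Matrix.mul_one, hP, jMat_eq]
      · rw [hDD]
    · congr 2
      · rw [Matrix.mul_assoc, Matrix.mul_assoc, hK, ← Matrix.mul_assoc (blockInd m g ⊗ₖ _),
          ← Matrix.mul_assoc, ← Matrix.mul_assoc, hDD]
      · rw [mul_vecMulVec, vecMulVec_mul, vecMul_transpose, hv]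

end Covariance

/-! ### The second moments of the score -/

section Fisher

/-- The second moments of linear combinations of functions. -/
theorem integrable_mulVec_mul {X α ι : Type*} [MeasurableSpace X] [Fintype ι] {ρ : Measure X}
    (N : Matrix α ι ℝ) {f : ι → X → ℝ}
    (hf : ∀ p q, Integrable (fun x => f p x * f q x) ρ) (a b : α) :
    Integrable (fun x => (N *ᵥ fun p => f p x) a * (N *ᵥ fun p => f p x) b) ρ := by
  simp only [mulVec, dotProduct, Finset.sum_mul_sum]
  refine integrable_finsetSum _ fun p _ => integrable_finsetSum _ fun q _ => ?_
  refine ((hf p q).const_mul (N a p * N b q)).congr (Filter.Eventually.of_forall fun x => ?_)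
  ring

theorem integral_mulVec_mul {X α ι : Type*} [MeasurableSpace X] [Fintype ι] {ρ : Measure X}
    (N : Matrix α ι ℝ) {f : ι → X → ℝ}
    (hf : ∀ p q, Integrable (fun x => f p x * f q x) ρ) (a b : α) :
    ∫ x, (N *ᵥ fun p => f p x) a * (N *ᵥ fun p => f p x) b ∂ρ
      = (N * (Matrix.of fun p q => ∫ x, f p x * f q x ∂ρ) * Nᵀ) a b := by
  have h : ∀ p q x, N a p * f p x * (N b q * f q x) = N a p * N b q * (f p x * f q x) :=
    fun p q x => by ring
  simp only [mulVec, dotProduct, Finset.sum_mul_sum, h]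
  rw [integral_finsetSum _ fun p _ => integrable_finsetSum _ fun q _ => (hf p q).const_mul _]
  simp only [mul_apply, Finset.sum_mul, of_apply, transpose_apply]
  rw [Finset.sum_comm]
  refine Finset.sum_congr rfl fun q _ => ?_
  rw [integral_finsetSum _ fun p _ => (hf q p).const_mul _]
  refine Finset.sum_congr rfl fun p _ => ?_
  rw [integral_const_mul]
  ring

variable {n G : ℕ} {m : Fin G → ℕ} {ν : Fin G → ℝ} {P : Matrix (Fin n) (Σ g, Fin (m g)) ℝ}
  {C : Matrix (Fin n) (Fin n) ℝ}

theorem measurable_scoreVec (ν : Fin G → ℝ) (P : Matrix (Fin n) (Σ g, Fin (m g)) ℝ)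
    (C : Matrix (Fin n) (Fin n) ℝ) : Measurable (scoreVec ν P C) := by
  refine measurable_pi_lambda _ fun q => ?_
  have hu : Measurable (uOf C) := (Continuous.matrix_mulVec continuous_const continuous_id).measurable
  have hv : ∀ g, Measurable fun z => vOf P C z g := fun g => (continuous_vOf P C g).measurable
  have hw : ∀ g, Measurable fun z => wOf ν P C z g := fun g =>
    (measurable_tWeight (ν g)).comp (hv g)
  simp only [scoreVec, Pi.sub_apply, Finset.sum_apply, Pi.smul_apply, vec, vecMulVec_apply,
    smul_eq_mul]
  refine (Finset.measurable_sum _ fun g _ => (hw g).mul (Measurable.mul ?_ ?_)).sub_const _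
  · exact (measurable_pi_apply q.2).comp
      ((Continuous.matrix_mulVec continuous_const continuous_id).measurable.comp (hv g))
  · exact (measurable_pi_apply q.1).comp hu

/-- At Z = C^{1/2} P V one has U = P V and P_g' U = V_g, so the weighted sum is P times a block
array times P', and I = P P' absorbs the centering. -/
theorem scoreVec_mulVec (hP : Pᵀ * P = 1) (hP' : P * Pᵀ = 1) (hC : C.PosDef)
    (V : ∀ g, Fin (m g) → ℝ) :
    scoreVec ν P C ((matSqrt C * P) *ᵥ fun s : Σ g, Fin (m g) => V s.1 s.2)
      = (P ⊗ₖ P) *ᵥ fun p => centeredEntry ν p V := by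
  set w : (Σ g, Fin (m g)) → ℝ := fun s => V s.1 s.2 with hw
  have h1 : (fun p => centeredEntry ν p V) = vec (vecMulVec (fun s => tWeight (ν s.1) (V s.1) * w s) w)
      - vec (1 : Matrix (Σ g, Fin (m g)) (Σ g, Fin (m g)) ℝ) := by
    ext p
    simp [centeredEntry, weightedEntry, vec, vecMulVec_apply, one_apply, hw]
  have h2 : ∀ g, vOf P C ((matSqrt C * P) *ᵥ w) g = V g := fun g => vOf_mulVec hP hC w g
  have h3 : ∀ g, wOf ν P C ((matSqrt C * P) *ᵥ w) g = tWeight (ν g) (V g) := fun g => by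
    rw [wOf, h2, tWeight]
  rw [h1, mulVec_sub, kronecker_mulVec_vec, kronecker_mulVec_vec, Matrix.mul_one, hP', scoreVec,
    uOf_mulVec hC]
  simp only [h2, h3]
  congr 1
  ext ⟨j, i⟩
  rw [mul_vecMulVec, vecMulVec_mul, vecMul_transpose]
  simp only [Finset.sum_apply, Pi.smul_apply, vec, vecMulVec_apply, smul_eq_mul, ← mul_assoc]
  rw [← Finset.sum_mul]
  congr 1
  simp only [mulVec, dotProduct, Fintype.sum_sigma, Finset.mul_sum, colBlock, submatrix_apply, id,
    hw]
  exact Finset.sum_congr rfl fun g _ => Finset.sum_congr rfl fun k _ => by ring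

/-- The law of Z is an image of the block law, so the expectation is computed over V; `N` will be
M'Ω. -/
theorem integral_mulVec_scoreVec_mul (m : Fin G → ℕ) (hm : n = ∑ g, m g) {ν : Fin G → ℝ} (hν : ∀ g, 2 < ν g)
    {P : Matrix (Fin n) (Σ g, Fin (m g)) ℝ} (hP : Pᵀ * P = 1)
    (hC : C.PosDef) {α : Type*} (N : Matrix α (Fin n × Fin n) ℝ) (a b : α)
    {Ω : Type*} [MeasurableSpace Ω] {μ : Measure Ω}
    {Z : Ω → Fin n → ℝ} (hZ : HasLaw Z (ctStd m ν (matSqrt C * P)) μ) :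
    Integrable (fun ω => (N *ᵥ scoreVec ν P C (Z ω)) a * (N *ᵥ scoreVec ν P C (Z ω)) b) μ ∧
    ∫ ω, (N *ᵥ scoreVec ν P C (Z ω)) a * (N *ᵥ scoreVec ν P C (Z ω)) b ∂μ
      = (N * (commMat n + upsilonMat ν P) * Nᵀ) a b := by
  have hP' := mul_transpose_self_of_card hm hP
  have hT : Measurable fun V : ∀ g, Fin (m g) → ℝ =>
      (matSqrt C * P) *ᵥ fun s : Σ g, Fin (m g) => V s.1 s.2 := by
    refine Continuous.measurable (Continuous.matrix_mulVec continuous_const ?_)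
    fun_prop
  have hN : ∀ c : α, Measurable fun z => (N *ᵥ scoreVec ν P C z) c := fun c =>
    Finset.measurable_sum _ fun q _ =>
      ((measurable_pi_apply q).comp (measurable_scoreVec ν P C)).const_mul _
  have hF : AEStronglyMeasurable
      (fun z => (N *ᵥ scoreVec ν P C z) a * (N *ᵥ scoreVec ν P C z) b)
      (ctStd m ν (matSqrt C * P)) := ((hN a).mul (hN b)).aestronglyMeasurable
  have hV : ∀ V : ∀ g, Fin (m g) → ℝ,
      N *ᵥ scoreVec ν P C ((matSqrt C * P) *ᵥ fun s : Σ g, Fin (m g) => V s.1 s.2)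
        = (N * (P ⊗ₖ P)) *ᵥ fun p => centeredEntry ν p V := fun V => by
    rw [scoreVec_mulVec hP hP' hC, mulVec_mulVec]
  have hi := integrable_mulVec_mul (N * (P ⊗ₖ P)) (integrable_centeredEntry_mul (m := m) hν) a b
  have hs := integral_mulVec_mul (N * (P ⊗ₖ P)) (integrable_centeredEntry_mul (m := m) hν) a b
  constructor
  · have : Integrable (fun z => (N *ᵥ scoreVec ν P C z) a * (N *ᵥ scoreVec ν P C z) b)
        (μ.map Z) := by
      rw [hZ.map_eq, ctStd, integrable_map_measure hF hT.aemeasurable]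
      refine hi.congr (Filter.Eventually.of_forall fun V => ?_)
      simp only [Function.comp, hV]
    exact this.comp_aemeasurable hZ.aemeasurable
  · have := hZ.integral_comp hF
    simp only [Function.comp_def] at this
    rw [this, ctStd, integral_map hT.aemeasurable hF]
    simp only [hV]
    rw [hs]
    simp only [integral_centeredEntry_mul hν]
    rw [← kronecker_mul_blockCov_mul ν hP', transpose_mul]
    simp only [Matrix.mul_assoc]
    rfl

end Fisher

end ConvT

end

theorem theorem2 {Ω : Type*} [MeasurableSpace Ω] (μ : Measure Ω) [IsProbabilityMeasure μ]
    (n G : ℕ) (m : Fin G → ℕ) (hm : n = ∑ g, m g)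
    (ν : Fin G → ℝ) (hν : ∀ g, 2 < ν g)
    -- the orthonormal matrix `P = (P_1, …, P_G)`, square because of `hm`
    (P : Matrix (Fin n) (Σ g, Fin (m g)) ℝ) (hP : Pᵀ * P = 1)
    (C : Matrix (Fin n) (Fin n) ℝ) (hC : ConvT.IsCorrelation C)
    -- any spectral decomposition of `log C`
    (Q : Matrix (Fin n) (Fin n) ℝ) (lam : Fin n → ℝ) (hQ : Qᵀ * Q = 1)
    (hlog : ConvT.matLog C = Q * diagonal lam * Qᵀ)
    (Z : Ω → Fin n → ℝ) (hZ : HasLaw Z (ConvT.ctStd m ν (ConvT.matSqrt C * P)) μ) :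
    -- `C` is the value at `γ = vecl (log C)` of the parametrization,
    ConvT.corrOf (ConvT.vecl (ConvT.matLog C)) = C ∧
    -- `ℓ` is the logarithm of the density of `CT(0, C^{1/2} P)`,
    ConvT.ctStd m ν (ConvT.matSqrt C * P) =
      volume.withDensity (fun z => ENNReal.ofReal (Real.exp (ConvT.logLik m ν P C z))) ∧
    -- the inverses that occur in `Ω` and `M` exist,
    IsUnit (ConvT.kronSum (ConvT.matSqrt C) 1) ∧
    IsUnit (ConvT.elimD n * ConvT.gammaMat Q lam * (ConvT.elimD n)ᵀ) ∧
    -- `M = ∂vec(C) / ∂γ'`,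
    HasFDerivAt (fun γ : ConvT.BelowDiag n → ℝ => vec (ConvT.corrOf γ))
      (LinearMap.toContinuousLinearMap (ConvT.mMat Q lam).mulVecLin)
      (ConvT.vecl (ConvT.matLog C)) ∧
    -- the score
    (∀ z : Fin n → ℝ,
      DifferentiableAt ℝ (ConvT.logLikParam m ν P z) (ConvT.vecl (ConvT.matLog C)) ∧
      ConvT.score m ν P (ConvT.vecl (ConvT.matLog C)) z =
        ((ConvT.mMat Q lam)ᵀ * ConvT.omegaMat C) *ᵥ
          (∑ g, ConvT.wOf ν P C z g •
              vec (vecMulVec (ConvT.colBlock P g *ᵥ ConvT.vOf P C z g) (ConvT.uOf C z))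
            - vec (1 : Matrix (Fin n) (Fin n) ℝ))) ∧
    -- the Fisher information matrix `E(∇ ∇')`
    (∀ a b : ConvT.BelowDiag n,
      Integrable (fun ω => ConvT.score m ν P (ConvT.vecl (ConvT.matLog C)) (Z ω) a
        * ConvT.score m ν P (ConvT.vecl (ConvT.matLog C)) (Z ω) b) μ) ∧
    (Matrix.of fun a b : ConvT.BelowDiag n =>
        ∫ ω, ConvT.score m ν P (ConvT.vecl (ConvT.matLog C)) (Z ω) a
          * ConvT.score m ν P (ConvT.vecl (ConvT.matLog C)) (Z ω) b ∂μ) =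
      (ConvT.mMat Q lam)ᵀ * ConvT.omegaMat C * (ConvT.commMat n + ConvT.upsilonMat ν P)
        * ConvT.omegaMat C * ConvT.mMat Q lam := by
  have h𝓘 := ConvT.integral_mulVec_scoreVec_mul m hm hν hP hC.1
    ((ConvT.mMat Q lam)ᵀ * ConvT.omegaMat C) (hZ := hZ)
  have hs := fun z => ConvT.score_eq m hν P hC hQ hlog z
  refine ⟨ConvT.corrOf_vecl_matLog hC, ConvT.ctStd_eq_withDensity hm hν hP hC.1,
    ConvT.isUnit_kronSum_matSqrt hC.1, (ConvT.posDef_elimD_gammaMat hQ lam).isUnit,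
    ConvT.hasFDerivAt_vec_corrOf hC hQ hlog,
    fun z => ⟨ConvT.differentiableAt_logLikParam m hν P hC z, hs z⟩, fun a b => ?_, ?_⟩
  · simp only [hs]
    exact (h𝓘 a b).1
  · ext a b
    simp only [hs, of_apply]
    -- The transpose of M'Ω is ΩM because Ω is symmetric.
    rw [(h𝓘 a b).2, transpose_mul, transpose_transpose, ConvT.transpose_omegaMat hC.1]
    simp only [Matrix.mul_assoc]
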